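/- **Setting.** Let $1\le K\le p$ and $n\ge 1$ be integers, $A\in\mathbb R^{p\times K}$, $\beta\in\mathbb R^K$. Let $Z\in\mathbb R^K$, $E\in\mathbb R^p$, $\varepsilon\in\mathbb R$ be mutually independent, mean zero, with finite second moments, and let $(X,y)$ follow the factor regression model $$X=AZ+E,\qquad y=Z^\top\beta+\varepsilon .$$ Write $\Sigma_X,\Sigma_Z,\Sigma_E$ for the covariance matrices of $X,Z,E$, $\sigma_y^2=\mathrm{Var}(y)$, $\sigma_\varepsilon^2=\mathrm{Var}(\varepsilon)$, $\|v\|_Q^2=v^\top Qv$, $\lambda_1(Q)\ge\lambda_2(Q)\ge\dots$ for the ordered eigenvalues of a symmetric matrix $Q$, $\Sigma^{1/2}$ for the positive semidefinite square root, and $\|U\|_{\psi_2}=\inf\{t>0:\mathbb E\exp(U^2/t^2)\le 2\}$ for the sub-Gaussian norm of a real random variable $U$. Let $$\xi=\frac{\lambda_K(A\Sigma_ZA^\top)}{\|\Sigma_E\|},\qquad \kappa(\Sigma_E)=\frac{\lambda_1(\Sigma_E)}{\lambda_p(\Sigma_E)} ,$$ where $\|\cdot\|$ is the operator norm. The data are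 $n$ pairs $X_i=AZ_i+E_i$, $y_i=Z_i^\top\beta+\varepsilon_i$, where $(Z_i,E_i,\varepsilon_i)$, $i=1,\dots,n$, are i.i.d. copies of $(Z,E,\varepsilon)$. Let $\mathbf X\in\mathbb R^{n\times p}$ be the matrix with rows $X_i$, $\mathbf y=(y_1,\dots,y_n)^\top$, $\widehat\alpha=\mathbf X^+\mathbf y$ with $\mathbf X^+$ the Moore-Penrose pseudo-inverse, and $R(\alpha)=\mathbb E_{(X,y)}[(X^\top\alpha-y)^2]$, the expectation being over a new pair $(X,y)$ independent of the data, so that $R(\widehat\alpha)$ is a function of the data. **Assumptions.** Let $M>0$. 1. $X=\Sigma_X^{1/2}\tilde X$ and $y=\sigma_y\tilde y$ almost surely, where $\tilde X\in\mathbb R^p$ has independent entries, and the entries of $\tilde X$ and $\tilde y$ have mean zero, unit variance and $\psi_2$-norm at most $M$. 2. $A$ and $\Sigma_Z$ have rank $K$. 3. $E=\Sigma_E^{1/2}\tilde E$, $Z=\Sigma_Z^{1/2}\tilde Z$ and $\varepsilon=\sigma_\varepsilon\tilde\varepsilon$ almost surely, where $\tilde E\in\mathbb R^p$ has independent entries with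 mean zero, unit variance and $\psi_2$-norm at most $M$, and the entries of $\tilde Z\in\mathbb R^K$, and $\tilde\varepsilon$, have mean zero and $\psi_2$-norm at most $M$. **Theorem.** For every $M>0$ there are constants $C,c,C'>0$, depending only on $M$, such that whenever the above assumptions hold and $n>C\,p$ (and $p\ge K$), with probability at least $1-c/n$ over the data, $$R(\widehat\alpha)-\sigma_\varepsilon^2\;\le\; C'\left(\kappa(\Sigma_E)\,\frac{\|\beta\|_{\Sigma_Z}^2}{\xi}+\frac pn\,\sigma_\varepsilon^2\log n\right).$$ Here, if $\Sigma_E=0$, then $\xi=\infty$ and the first term on the right is $0$; if $\Sigma_E\ne0$ is singular, then $\kappa(\Sigma_E)=\infty$ and the first term is $+\infty$ when $\beta\neq0$ and $0$ when $\beta=0$. -/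

import Mathlib

open MeasureTheory ProbabilityTheory
open scoped ENNReal

namespace FactorRegression

section LinearAlgebra

/-- `G` is a Moore-Penrose inverse of the real matrix `B`: the four Penrose conditions. -/
structure IsMoorePenrose {m k : ℕ} (B : Matrix (Fin m) (Fin k) ℝ)
    (G : Matrix (Fin k) (Fin m) ℝ) : Prop where
  mul_mul_self : B * G * B = B
  self_mul_mul : G * B * G = G
  symm_left : (B * G).IsSymm
  symm_right : (G * B).IsSymm

theorem IsMoorePenrose.unique {m k : ℕ} {B : Matrix (Fin m) (Fin k) ℝ}
    {G H : Matrix (Fin k) (Fin m) ℝ} (hG : IsMoorePenrose B G) (hH : IsMoorePenrose B H) :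
    G = H := by
  have h1 : B * G = B * H := by
    have e1 : B * G = (B * H) * (B * G) := by
      rw [← Matrix.mul_assoc, hH.mul_mul_self]
    have e2 : B * H = (B * G) * (B * H) := by
      rw [← Matrix.mul_assoc, hG.mul_mul_self]
    have e3 := congrArg Matrix.transpose e2
    rw [Matrix.transpose_mul (B * G) (B * H), hH.symm_left.eq, hG.symm_left.eq] at e3
    rw [e1, ← e3]
  have h2 : G * B = H * B := by
    have e1 : G * B = (G * B) * (H * B) := by
      rw [Matrix.mul_assoc, ← Matrix.mul_assoc B H B, hH.mul_mul_self]
    have e2 : H * B = (H * B) * (G * B) := by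
      rw [Matrix.mul_assoc, ← Matrix.mul_assoc B G B, hG.mul_mul_self]
    have e3 := congrArg Matrix.transpose e2
    rw [Matrix.transpose_mul (H * B) (G * B), hH.symm_right.eq, hG.symm_right.eq] at e3
    rw [e1, ← e3]
  calc G = G * B * G := hG.self_mul_mul.symm
    _ = H * (B * G) := by rw [h2, Matrix.mul_assoc]
    _ = H * B * H := by rw [h1, Matrix.mul_assoc]
    _ = H := hH.self_mul_mul

theorem exists_isMoorePenrose {m k : ℕ} (B : Matrix (Fin m) (Fin k) ℝ) :
    ∃ G, IsMoorePenrose B G := by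
  have hH : (B.transpose * B).IsHermitian := by
    have := Matrix.isHermitian_conjTranspose_mul_self B
    rwa [Matrix.conjTranspose_eq_transpose_of_trivial] at this
  obtain ⟨U, d, hU, hUd⟩ : ∃ (U : Matrix (Fin k) (Fin k) ℝ) (d : Fin k → ℝ),
      U.transpose * U = 1 ∧ B.transpose * B = U * Matrix.diagonal d * U.transpose := by
    refine ⟨hH.eigenvectorUnitary, hH.eigenvalues, ?_, ?_⟩
    · have := Unitary.coe_star_mul_self hH.eigenvectorUnitary
      rwa [Matrix.star_eq_conjTranspose, Matrix.conjTranspose_eq_transpose_of_trivial] at this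
    · have := hH.spectral_theorem
      rw [Unitary.conjStarAlgAut_apply, Matrix.star_eq_conjTranspose,
        Matrix.conjTranspose_eq_transpose_of_trivial] at this
      exact this
  set D := Matrix.diagonal d with hD
  set D' := Matrix.diagonal (fun i => (d i)⁻¹) with hD'
  have hDDD : D * D' * D = D := by
    simp only [hD, hD', Matrix.diagonal_mul_diagonal, mul_inv_mul_cancel]
  have hDDD' : D' * D * D' = D' := by
    simp only [hD, hD', Matrix.diagonal_mul_diagonal]
    congr 1; ext i
    by_cases h : d i = 0 <;> simp [h]
  have hcomm : D * D' = D' * D := by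
    simp only [hD, hD', Matrix.diagonal_mul_diagonal, mul_comm]
  have hcancel : ∀ S T : Matrix (Fin k) (Fin k) ℝ,
      (U * S * U.transpose) * (U * T * U.transpose) = U * (S * T) * U.transpose := by
    intro S T
    calc (U * S * U.transpose) * (U * T * U.transpose)
        = U * S * (U.transpose * U) * T * U.transpose := by simp only [Matrix.mul_assoc]
      _ = _ := by rw [hU]; simp only [Matrix.mul_assoc, Matrix.one_mul]
  set H := B.transpose * B with hHdef
  set G := U * D' * U.transpose with hG
  have hGT : G.transpose = G := by
    simp only [hG, hD', Matrix.transpose_mul, Matrix.transpose_transpose,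
      Matrix.diagonal_transpose, Matrix.mul_assoc]
  have hHT : H.transpose = H := by
    simp only [hHdef, Matrix.transpose_mul, Matrix.transpose_transpose]
  have hHGH : H * G * H = H := by rw [hUd, hG, hcancel, hcancel, hDDD]
  have hGHG : G * H * G = G := by rw [hUd, hG, hcancel, hcancel, hDDD']
  have hGH : H * G = G * H := by rw [hUd, hG, hcancel, hcancel, hcomm]
  have hB : B * G * H = B := by
    have hz : (B * G * H - B).transpose * (B * G * H - B) = 0 := by
      have : (B * G * H - B).transpose = H * G * B.transpose - B.transpose := by
        rw [Matrix.transpose_sub, Matrix.transpose_mul (B * G) H, Matrix.transpose_mul B G, hGT,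
          hHT, Matrix.mul_assoc H G]
      rw [this, Matrix.sub_mul, Matrix.mul_sub, Matrix.mul_sub]
      have a1 : H * G * B.transpose * (B * G * H) = H := by
        calc H * G * B.transpose * (B * G * H) = H * G * H * G * H := by
              rw [hHdef]; simp only [Matrix.mul_assoc]
          _ = H := by rw [hHGH, hHGH]
      have a2 : H * G * B.transpose * B = H := by rw [Matrix.mul_assoc (H * G), ← hHdef, hHGH]
      have a3 : B.transpose * (B * G * H) = H := by
        rw [← Matrix.mul_assoc, ← Matrix.mul_assoc B.transpose, ← hHdef, hHGH]
      rw [a1, a2, a3, ← hHdef]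
      simp
    have := (Matrix.conjTranspose_mul_self_eq_zero (A := B * G * H - B)).1 (by
      rwa [Matrix.conjTranspose_eq_transpose_of_trivial])
    exact sub_eq_zero.1 this
  refine ⟨G * B.transpose, ?_, ?_, ?_, ?_⟩
  · rw [← Matrix.mul_assoc, Matrix.mul_assoc (B * G), ← hHdef, hB]
  · rw [Matrix.mul_assoc G B.transpose B, ← hHdef, ← Matrix.mul_assoc, hGHG]
  · rw [Matrix.IsSymm, Matrix.transpose_mul, Matrix.transpose_mul G, Matrix.transpose_transpose,
      hGT, Matrix.mul_assoc]
  · rw [Matrix.IsSymm, Matrix.mul_assoc, ← hHdef, Matrix.transpose_mul, hGT, hHT, hGH]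

/-- The Moore-Penrose pseudo-inverse of a real matrix. -/
noncomputable def pinv {m k : ℕ} (B : Matrix (Fin m) (Fin k) ℝ) : Matrix (Fin k) (Fin m) ℝ :=
  Classical.choose (exists_isMoorePenrose B)

theorem pinv_spec {m k : ℕ} (B : Matrix (Fin m) (Fin k) ℝ) : IsMoorePenrose B (pinv B) :=
  Classical.choose_spec (exists_isMoorePenrose B)

/-- The `k`-th largest eigenvalue (`k = 1, …, d`, counted with multiplicity) of a symmetric
`d × d` real matrix. -/
noncomputable def ordEig {d : ℕ} (Q : Matrix (Fin d) (Fin d) ℝ) (k : ℕ) : ℝ :=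
  open Classical in
  if h : Q.IsHermitian ∧ 1 ≤ k ∧ k ≤ d then
    h.1.eigenvalues₀ ⟨k - 1, by rw [Fintype.card_fin]; omega⟩
  else 0

/-- The Euclidean operator norm of a square matrix. -/
noncomputable def opNorm {d : ℕ} (Q : Matrix (Fin d) (Fin d) ℝ) : ℝ :=
  ‖Matrix.toEuclideanCLM (n := Fin d) (𝕜 := ℝ) Q‖

/-- `‖v‖²_Q = vᵀ Q v`. -/
def sqNormOf {d : ℕ} (Q : Matrix (Fin d) (Fin d) ℝ) (v : Fin d → ℝ) : ℝ :=
  v ⬝ᵥ Q.mulVec v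

open scoped MatrixOrder in
/-- The positive semidefinite square root of a positive semidefinite matrix. -/
noncomputable def psdSqrt {d : ℕ} (Q : Matrix (Fin d) (Fin d) ℝ) : Matrix (Fin d) (Fin d) ℝ :=
  CFC.sqrt Q

/-- Condition number `λ₁(Q) / λ_d(Q)` of a positive semidefinite `d × d` matrix, with values
in `[0, ∞]`; it is `∞` for a singular nonzero `Q`. -/
noncomputable def condNumber {d : ℕ} (Q : Matrix (Fin d) (Fin d) ℝ) : ℝ≥0∞ :=
  ENNReal.ofReal (ordEig Q 1) / ENNReal.ofReal (ordEig Q d)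

/-- Signal-to-noise ratio `ξ = λ_K(A Σ_Z Aᵀ) / ‖Σ_E‖`, with values in `[0, ∞]`; it is `∞` when
`Σ_E = 0` and the numerator is positive. -/
noncomputable def snr {p K : ℕ} (A : Matrix (Fin p) (Fin K) ℝ)
    (SigmaZ : Matrix (Fin K) (Fin K) ℝ) (SigmaE : Matrix (Fin p) (Fin p) ℝ) : ℝ≥0∞ :=
  ENNReal.ofReal (ordEig (A * SigmaZ * A.transpose) K) / ENNReal.ofReal (opNorm SigmaE)

end LinearAlgebra

section Probability

variable {Ω : Type*} [MeasurableSpace Ω]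

/-- The covariance matrix of a random vector. -/
noncomputable def covMat {d : ℕ} (P : Measure Ω) (V : Ω → Fin d → ℝ) :
    Matrix (Fin d) (Fin d) ℝ :=
  Matrix.of fun i j => cov[fun ω => V ω i, fun ω => V ω j; P]

/-- The sub-Gaussian norm `‖U‖_{ψ₂} = inf {t > 0 : 𝔼 exp(U² / t²) ≤ 2}`, with values in `[0, ∞]`
(the infimum of the empty set is `∞`). -/
noncomputable def psi2Norm (P : Measure Ω) (U : Ω → ℝ) : ℝ≥0∞ :=
  ⨅ (t : ℝ) (_ : 0 < t ∧ ∫⁻ ω, ENNReal.ofReal (Real.exp (U ω ^ 2 / t ^ 2)) ∂P ≤ 2),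
    ENNReal.ofReal t

/-- A real random variable with zero mean and sub-Gaussian norm at most `M`. -/
structure IsCenteredSubGaussian (P : Measure Ω) (M : ℝ) (U : Ω → ℝ) : Prop where
  measurable : Measurable U
  mean_zero : ∫ ω, U ω ∂P = 0
  psi2_le : psi2Norm P U ≤ ENNReal.ofReal M

/-- A real random variable with zero mean, unit variance and sub-Gaussian norm at most `M`. -/
structure IsStandardSubGaussian (P : Measure Ω) (M : ℝ) (U : Ω → ℝ) : Prop
    extends IsCenteredSubGaussian P M U where
  var_one : Var[U; P] = 1

/-- The features `X = A Z + E`. -/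
def features {p K : ℕ} (A : Matrix (Fin p) (Fin K) ℝ) (Z : Ω → Fin K → ℝ)
    (E : Ω → Fin p → ℝ) : Ω → Fin p → ℝ :=
  fun ω => A.mulVec (Z ω) + E ω

/-- The response `y = Zᵀ β + ε`. -/
def response {K : ℕ} (β : Fin K → ℝ) (Z : Ω → Fin K → ℝ) (ε : Ω → ℝ) : Ω → ℝ :=
  fun ω => Z ω ⬝ᵥ β + ε ω

/-- The conditions on the latent vector `Z` and the noise terms `E`, `ε` in the factor regression
model: square integrable, mean zero, and mutually independent. -/
structure IsFactorTriple {p K : ℕ} (P : Measure Ω) (Z : Ω → Fin K → ℝ)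
    (E : Ω → Fin p → ℝ) (ε : Ω → ℝ) : Prop where
  measurable_Z : Measurable Z
  measurable_E : Measurable E
  measurable_ε : Measurable ε
  memLp_Z : ∀ a, MemLp (fun ω => Z ω a) 2 P
  memLp_E : ∀ j, MemLp (fun ω => E ω j) 2 P
  memLp_ε : MemLp ε 2 P
  mean_Z : ∀ a, ∫ ω, Z ω a ∂P = 0
  mean_E : ∀ j, ∫ ω, E ω j ∂P = 0
  mean_ε : ∫ ω, ε ω ∂P = 0
  indep_E_ε : IndepFun E ε P
  indep_Z_noise : IndepFun Z (fun ω => (E ω, ε ω)) P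

/-- Joint distributional assumption on `(X, y)`: `X = Σ_X^{1/2} X̃` and `y = σ_y ỹ`, where `X̃` has
independent entries, and the entries of `X̃` and `ỹ` have zero mean, unit variance and
sub-Gaussian norms at most `M`. -/
def SubGaussianData {p : ℕ} (P : Measure Ω) (M : ℝ) (X : Ω → Fin p → ℝ) (y : Ω → ℝ) : Prop :=
  (∃ Xt : Ω → Fin p → ℝ,
    iIndepFun (fun j ω => Xt ω j) P ∧
    (∀ j, IsStandardSubGaussian P M (fun ω => Xt ω j)) ∧
    ∀ᵐ ω ∂P, X ω = (psdSqrt (covMat P X)).mulVec (Xt ω)) ∧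
  ∃ yt : Ω → ℝ, IsStandardSubGaussian P M yt ∧ ∀ᵐ ω ∂P, y ω = √(Var[y; P]) * yt ω

/-- Distributional assumption on the factor model: `E = Σ_E^{1/2} Ẽ` where `Ẽ` has independent
entries with zero mean, unit variance and sub-Gaussian norms at most `M`; `Z = Σ_Z^{1/2} Z̃` and
`ε = σ_ε ε̃`, where `Z̃` and `ε̃` have zero mean and (entrywise) sub-Gaussian norms at most `M`. -/
def SubGaussianFactors {p K : ℕ} (P : Measure Ω) (M : ℝ) (Z : Ω → Fin K → ℝ)
    (E : Ω → Fin p → ℝ) (ε : Ω → ℝ) : Prop :=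
  (∃ Et : Ω → Fin p → ℝ,
    iIndepFun (fun j ω => Et ω j) P ∧
    (∀ j, IsStandardSubGaussian P M (fun ω => Et ω j)) ∧
    ∀ᵐ ω ∂P, E ω = (psdSqrt (covMat P E)).mulVec (Et ω)) ∧
  (∃ Zt : Ω → Fin K → ℝ,
    (∀ a, IsCenteredSubGaussian P M (fun ω => Zt ω a)) ∧
    ∀ᵐ ω ∂P, Z ω = (psdSqrt (covMat P Z)).mulVec (Zt ω)) ∧
  ∃ εt : Ω → ℝ, IsCenteredSubGaussian P M εt ∧ ∀ᵐ ω ∂P, ε ω = √(Var[ε; P]) * εt ω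

/-- `(Zs i, Es i, εs i)`, `i = 1, …, n`, defined on `(Ω', P')`, are independent copies of
`(Z, E, ε)`. -/
structure IsIIDSample {Ω' : Type*} [MeasurableSpace Ω'] {n p K : ℕ}
    (P : Measure Ω) (Z : Ω → Fin K → ℝ) (E : Ω → Fin p → ℝ) (ε : Ω → ℝ)
    (P' : Measure Ω') (Zs : Fin n → Ω' → Fin K → ℝ) (Es : Fin n → Ω' → Fin p → ℝ)
    (εs : Fin n → Ω' → ℝ) : Prop where
  indep : iIndepFun (fun i ω => (Zs i ω, Es i ω, εs i ω)) P'
  identDistrib : ∀ i, IdentDistrib (fun ω => (Zs i ω, Es i ω, εs i ω))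
    (fun ω => (Z ω, E ω, ε ω)) P' P

/-- The prediction risk `R(α) = 𝔼 (Xᵀ α - y)²`, an expectation over the population `(X, y)`. -/
noncomputable def risk {p : ℕ} (P : Measure Ω) (X : Ω → Fin p → ℝ) (y : Ω → ℝ)
    (α : Fin p → ℝ) : ℝ :=
  ∫ ω, (X ω ⬝ᵥ α - y ω) ^ 2 ∂P

/-- The estimator `α̂ = 𝐗⁺ 𝐲` computed at the sample point `ω`; row `i` of `𝐗` is `X_i`. -/
noncomputable def gls {n p : ℕ} (Xs : Fin n → Ω → Fin p → ℝ) (ys : Fin n → Ω → ℝ) (ω : Ω) :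
    Fin p → ℝ :=
  (pinv (Matrix.of fun i j => Xs i ω j)).mulVec fun i => ys i ω

end Probability

end FactorRegression

/-!
Choose `v` with `Aᵀ v = β` and `λ_K(A Σ_Z Aᵀ) ‖v‖² ≤ ‖β‖²_{Σ_Z}`. Then `y = Xᵀ v + ε - Eᵀ v`, so the
response is a linear function of the features up to the error `ε` and the small term `Eᵀ v`, whose
second moment is at most `‖Σ_E‖ ‖v‖² ≤ ‖β‖²_{Σ_Z} / ξ`. Since `ε` is uncorrelated with `X` and `E`,
the excess risk of `α` is at most `2 ‖α - v‖²_{Σ_X} + 2 ‖v‖²_{Σ_E}`.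

With high probability, three bounds hold simultaneously: `‖𝐗 b‖² ≥ n / 2 ‖b‖²_{Σ_X}` for all `b`;
the cross terms `∑ i, (bᵀ X_i) ε_i` are of order `√(p n log n) σ_ε ‖b‖_{Σ_X}` uniformly in `b`; and
`∑ i, (vᵀ E_i)² ≤ 2 n ‖v‖²_{Σ_E}`. On this event the normal equations for `α̂` bound
`‖α̂ - v‖²_{Σ_X}`. The first two bounds follow from Bernstein's inequality for products of
sub-Gaussian variables, after whitening the features: the design bound by a net argument, the cross
terms coordinate by coordinate.
-/

namespace FactorRegression

section ExpInequalities

open Real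

theorem exp_le_add_exp_sq (x : ℝ) : exp x ≤ x + exp (x ^ 2) := by
  have hsq : x ^ 2 + 1 ≤ exp (x ^ 2) := add_one_le_exp _
  rcases le_total x (-1) with hx | hx
  · have : exp x ≤ 1 := exp_le_one_iff.2 (by linarith)
    nlinarith
  rcases le_total x 1 with hx' | hx'
  · linarith [(abs_le.1 (abs_exp_sub_one_sub_id_le (abs_le.2 ⟨hx, hx'⟩))).2]
  · linarith [exp_le_exp.2 (show x ≤ x ^ 2 by nlinarith)]

theorem exp_mul_le_one_sub_add {a : ℝ} (h0 : 0 ≤ a) (h1 : a ≤ 1) (y : ℝ) :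
    exp (a * y) ≤ 1 - a + a * exp y := by
  have := convexOn_exp.2 (Set.mem_univ y) (Set.mem_univ 0) h0 (sub_nonneg.2 h1) (by ring)
  simp only [smul_eq_mul, mul_zero, add_zero, exp_zero, mul_one] at this
  linarith

theorem exp_le_one_add_add_sq_mul_exp_abs (x : ℝ) : exp x ≤ 1 + x + x ^ 2 * exp |x| := by
  have hone : 1 ≤ exp |x| := one_le_exp (abs_nonneg x)
  rcases le_total |x| 1 with hx | hx
  · nlinarith [(abs_le.1 (abs_exp_sub_one_sub_id_le hx)).2, sq_nonneg x]
  · have hsq : 1 ≤ x ^ 2 := (one_le_sq_iff_one_le_abs x).2 hx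
    rcases le_total 0 x with h0 | h0
    · rw [abs_of_nonneg h0] at *
      nlinarith
    · rw [abs_of_nonpos h0] at *
      nlinarith [exp_le_one_iff.2 h0]

theorem exp_mul_le_one_add_add_mul_exp {l θ : ℝ} (hθ : 0 < θ) (hl : |l| ≤ θ / 2) (y : ℝ) :
    exp (l * y) ≤ 1 + l * y + 8 * l ^ 2 / θ ^ 2 * exp (θ * |y|) := by
  refine (exp_le_one_add_add_sq_mul_exp_abs _).trans (add_le_add le_rfl ?_)
  have hly : |l * y| ≤ θ * |y| / 2 := by
    rw [abs_mul, mul_div_right_comm]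
    gcongr
  have hsq : (θ * |y| / 2) ^ 2 ≤ 2 * exp (θ * |y| / 2) := by
    have hz : 0 ≤ θ * |y| / 2 := by positivity
    nlinarith [quadratic_le_exp_of_nonneg hz]
  calc (l * y) ^ 2 * exp |l * y|
      = 4 * l ^ 2 / θ ^ 2 * ((θ * |y| / 2) ^ 2 * exp |l * y|) := by
        rw [mul_pow, ← sq_abs y]; field_simp; ring
    _ ≤ 4 * l ^ 2 / θ ^ 2 * (2 * exp (θ * |y| / 2) * exp (θ * |y| / 2)) := by gcongr
    _ = 8 * l ^ 2 / θ ^ 2 * exp (θ * |y|) := by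
        rw [mul_assoc 2, ← exp_add, add_halves]; ring

end ExpInequalities

section SubGaussian

open Real
open scoped NNReal

variable {Ω : Type*} [MeasurableSpace Ω] {P : Measure Ω}

theorem hasSubgaussianMGF_mono {U : Ω → ℝ} {c c' : ℝ≥0} (h : HasSubgaussianMGF U c P)
    (hc : c ≤ c') : HasSubgaussianMGF U c' P :=
  ⟨h.integrable_exp_mul, fun t => (h.mgf_le t).trans (exp_le_exp.2 (by gcongr))⟩

theorem hasSubgaussianMGF_const_mul {U : Ω → ℝ} {c c' : ℝ≥0} (h : HasSubgaussianMGF U c P) {r : ℝ}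
    (hr : r ^ 2 * c ≤ c') : HasSubgaussianMGF (fun ω => r * U ω) c' P :=
  hasSubgaussianMGF_mono (h.const_mul r) (NNReal.coe_le_coe.1 hr)

theorem integrable_exp_of_lintegral_lt_top {f : Ω → ℝ} (hf : AEMeasurable f P)
    (h : ∫⁻ ω, ENNReal.ofReal (exp (f ω)) ∂P < ∞) : Integrable (fun ω => exp (f ω)) P :=
  (lintegral_ofReal_ne_top_iff_integrable
    (measurable_exp.comp_aemeasurable hf).aestronglyMeasurable
    (ae_of_all _ fun _ => (exp_pos _).le)).1 h.ne

theorem integral_exp_le_of_lintegral_le {f : Ω → ℝ} {K : ℝ} (hK : 0 ≤ K) (hf : AEMeasurable f P)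
    (h : ∫⁻ ω, ENNReal.ofReal (exp (f ω)) ∂P ≤ ENNReal.ofReal K) : ∫ ω, exp (f ω) ∂P ≤ K := by
  rw [integral_eq_lintegral_of_nonneg_ae (ae_of_all _ fun _ => (exp_pos _).le)
    (measurable_exp.comp_aemeasurable hf).aestronglyMeasurable]
  exact ENNReal.toReal_le_of_le_ofReal hK h

section ExpSquare

variable [IsProbabilityMeasure P] {U : Ω → ℝ}

theorem exp_mul_le_exp_half_sq_mul (l u : ℝ) :
    exp (l * u) ≤ exp (l ^ 2 / 2) * (1 / 2 + 1 / 2 * exp (u ^ 2)) := by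
  have hamgm : l * u ≤ l ^ 2 / 2 + 1 / 2 * u ^ 2 := by nlinarith [sq_nonneg (l - u)]
  have hconv := exp_mul_le_one_sub_add (a := 1 / 2) (by norm_num) (by norm_num) (u ^ 2)
  calc exp (l * u) ≤ exp (l ^ 2 / 2) * exp (1 / 2 * u ^ 2) := by
        rw [← exp_add]; exact exp_le_exp.2 hamgm
    _ ≤ _ := by gcongr; linarith

theorem integrable_exp_mul_of_integrable_exp_sq (hU : AEMeasurable U P)
    (hi : Integrable (fun ω => exp (U ω ^ 2)) P) (l : ℝ) :
    Integrable (fun ω => exp (l * U ω)) P := by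
  refine (((integrable_const (1 / 2)).add (hi.const_mul (1 / 2))).const_mul
    (exp (l ^ 2 / 2))).mono' (by fun_prop) (ae_of_all _ fun ω => ?_)
  rw [norm_eq_abs, abs_of_pos (exp_pos _)]
  exact exp_mul_le_exp_half_sq_mul l (U ω)

theorem mgf_le_exp_sq_of_sq_le_one (hU : Integrable U P) (h0 : ∫ ω, U ω ∂P = 0)
    (hi : Integrable (fun ω => exp (U ω ^ 2)) P) (h2 : ∫ ω, exp (U ω ^ 2) ∂P ≤ 2) {l : ℝ}
    (hl : l ^ 2 ≤ 1) : mgf U P l ≤ exp (l ^ 2) := by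
  have hrest : Integrable (fun ω => 1 - l ^ 2 + l ^ 2 * exp (U ω ^ 2)) P :=
    (integrable_const _).add (hi.const_mul _)
  calc mgf U P l ≤ ∫ ω, (l * U ω + (1 - l ^ 2 + l ^ 2 * exp (U ω ^ 2))) ∂P := by
        refine integral_mono (integrable_exp_mul_of_integrable_exp_sq hU.aemeasurable hi l)
          ((hU.const_mul l).add hrest) fun ω => (exp_le_add_exp_sq _).trans ?_
        rw [mul_pow]
        gcongr
        exact exp_mul_le_one_sub_add (sq_nonneg l) hl _
    _ = 1 - l ^ 2 + l ^ 2 * ∫ ω, exp (U ω ^ 2) ∂P := by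
        rw [integral_add (hU.const_mul l) hrest, integral_add (integrable_const _)
          (hi.const_mul _), integral_const_mul, integral_const_mul, h0]
        simp
    _ ≤ l ^ 2 + 1 := by nlinarith [sq_nonneg l]
    _ ≤ exp (l ^ 2) := add_one_le_exp _

theorem mgf_le_exp_sq_of_one_le_sq (hU : AEMeasurable U P)
    (hi : Integrable (fun ω => exp (U ω ^ 2)) P) (h2 : ∫ ω, exp (U ω ^ 2) ∂P ≤ 2) {l : ℝ}
    (hl : 1 ≤ l ^ 2) : mgf U P l ≤ exp (l ^ 2) := by
  have hdom := (integrable_const (μ := P) (1 / 2)).add (hi.const_mul (1 / 2))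
  calc mgf U P l ≤ ∫ ω, exp (l ^ 2 / 2) * (1 / 2 + 1 / 2 * exp (U ω ^ 2)) ∂P :=
        integral_mono (integrable_exp_mul_of_integrable_exp_sq hU hi l) (hdom.const_mul _)
          fun ω => exp_mul_le_exp_half_sq_mul l (U ω)
    _ = exp (l ^ 2 / 2) * (1 / 2 + 1 / 2 * ∫ ω, exp (U ω ^ 2) ∂P) := by
        rw [integral_const_mul, integral_add (integrable_const _) (hi.const_mul _),
          integral_const_mul]
        simp
    _ ≤ exp (l ^ 2 / 2) * exp (l ^ 2 / 2) := by
        gcongr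
        linarith [add_one_le_exp (l ^ 2 / 2)]
    _ = exp (l ^ 2) := by rw [← exp_add, add_halves]

theorem hasSubgaussianMGF_of_lintegral_exp_sq_le_two (hU : AEMeasurable U P)
    (h0 : ∫ ω, U ω ∂P = 0) (h2 : ∫⁻ ω, ENNReal.ofReal (exp (U ω ^ 2)) ∂P ≤ 2) :
    HasSubgaussianMGF U 2 P := by
  have hi := integrable_exp_of_lintegral_lt_top (hU.pow_const 2)
    (h2.trans_lt ENNReal.ofNat_lt_top)
  have h2' := integral_exp_le_of_lintegral_le zero_le_two (hU.pow_const 2) (by simpa using h2)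
  have hUi : Integrable U P := by
    refine hi.mono' hU.aestronglyMeasurable (ae_of_all _ fun ω => ?_)
    rw [norm_eq_abs, ← sq_abs]
    nlinarith [add_one_le_exp (|U ω| ^ 2), sq_nonneg (|U ω| - 1)]
  refine ⟨integrable_exp_mul_of_integrable_exp_sq hU hi, fun l => ?_⟩
  rw [NNReal.coe_ofNat, mul_div_cancel_left₀ _ two_ne_zero]
  rcases le_total (l ^ 2) 1 with hl | hl
  · exact mgf_le_exp_sq_of_sq_le_one hUi h0 hi h2' hl
  · exact mgf_le_exp_sq_of_one_le_sq hU hi h2' hl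

theorem IsCenteredSubGaussian.hasSubgaussianMGF {M : ℝ} (hM : 0 < M)
    (h : IsCenteredSubGaussian P M U) : HasSubgaussianMGF U (8 * M ^ 2).toNNReal P := by
  obtain ⟨t, ht⟩ := iInf_lt_iff.1 (h.psi2_le.trans_lt
    ((ENNReal.ofReal_lt_ofReal_iff (by linarith : 0 < 2 * M)).2 (by linarith : M < 2 * M)))
  obtain ⟨⟨ht0, ht2⟩, htM⟩ := iInf_lt_iff.1 ht
  rw [ENNReal.ofReal_lt_ofReal_iff (by linarith)] at htM
  have hscaled : HasSubgaussianMGF (fun ω => t⁻¹ * U ω) 2 P := by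
    refine hasSubgaussianMGF_of_lintegral_exp_sq_le_two (h.measurable.const_mul _).aemeasurable
      (by rw [integral_const_mul, h.mean_zero, mul_zero]) ?_
    simpa only [inv_mul_eq_div, div_pow] using ht2
  have hrescale : ∀ ω, t * (t⁻¹ * U ω) = U ω := fun ω => mul_inv_cancel_left₀ ht0.ne' _
  simpa only [hrescale] using hasSubgaussianMGF_const_mul hscaled (r := t)
    (c' := (8 * M ^ 2).toNNReal) (by
      rw [coe_toNNReal _ (by positivity), NNReal.coe_ofNat]
      nlinarith)

end ExpSquare

section GaussianIntegration

theorem lintegral_exp_mul_gaussianReal (r : ℝ) :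
    ∫⁻ g, ENNReal.ofReal (exp (r * g)) ∂gaussianReal 0 1 = ENNReal.ofReal (exp (r ^ 2 / 2)) := by
  rw [← ofReal_integral_eq_lintegral_ofReal (integrable_exp_mul_gaussianReal _)
    (ae_of_all _ fun _ => (exp_pos _).le)]
  simpa [mgf] using congrArg ENNReal.ofReal (congrFun (mgf_id_gaussianReal (μ := 0) (v := 1)) r)

theorem lintegral_exp_mul_sq_gaussianReal {s : ℝ} (hs : s < 1) :
    ∫⁻ g, ENNReal.ofReal (exp (s / 2 * g ^ 2)) ∂gaussianReal 0 1 =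
      ENNReal.ofReal (√(1 - s))⁻¹ := by
  have hdensity : ∀ g, (gaussianPDF 0 1 * fun g => ENNReal.ofReal (exp (s / 2 * g ^ 2))) g =
      ENNReal.ofReal ((√(2 * π))⁻¹ * exp (-((1 - s) / 2) * g ^ 2)) := fun g => by
    simp only [Pi.mul_apply, gaussianPDF, gaussianPDFReal, NNReal.coe_one, mul_one, sub_zero]
    rw [← ENNReal.ofReal_mul (by positivity), mul_assoc, ← exp_add]
    ring_nf
  rw [gaussianReal_of_var_ne_zero _ one_ne_zero,
    lintegral_withDensity_eq_lintegral_mul _ (by fun_prop) (by fun_prop)]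
  simp_rw [hdensity]
  rw [← ofReal_integral_eq_lintegral_ofReal
    ((integrable_exp_neg_mul_sq (by linarith)).const_mul _) (ae_of_all _ fun _ => by positivity),
    integral_const_mul, integral_gaussian, ← sqrt_inv, ← sqrt_mul (by positivity), ← sqrt_inv]
  congr 2
  have : 1 - s ≠ 0 := by linarith
  field_simp

/-- The Gaussian trick: `exp (s U² / 2)` is the expectation of `exp (√s U g)` over an independent
standard Gaussian `g`, and the two integrals can be exchanged. -/
theorem lintegral_exp_sq_le_of_hasSubgaussianMGF [IsProbabilityMeasure P] {U : Ω → ℝ} {c : ℝ≥0}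
    (h : HasSubgaussianMGF U c P) {s : ℝ} (hs : 0 ≤ s) (hsc : s * c < 1) :
    ∫⁻ ω, ENNReal.ofReal (exp (s / 2 * U ω ^ 2)) ∂P ≤ ENNReal.ofReal (√(1 - s * c))⁻¹ := by
  have hU := h.aemeasurable
  have hmgf : ∀ g : ℝ, ∫⁻ ω, ENNReal.ofReal (exp (√s * U ω * g)) ∂P ≤
      ENNReal.ofReal (exp (s * c / 2 * g ^ 2)) := fun g => by
    simp only [mul_right_comm _ (U _), ← ofReal_integral_eq_lintegral_ofReal
      (h.integrable_exp_mul (√s * g)) (ae_of_all _ fun _ => (exp_pos _).le)]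
    refine ENNReal.ofReal_le_ofReal ((h.mgf_le (√s * g)).trans_eq ?_)
    rw [mul_pow, sq_sqrt hs]
    ring_nf
  calc ∫⁻ ω, ENNReal.ofReal (exp (s / 2 * U ω ^ 2)) ∂P
      = ∫⁻ ω, ∫⁻ g, ENNReal.ofReal (exp (√s * U ω * g)) ∂gaussianReal 0 1 ∂P := by
        simp_rw [lintegral_exp_mul_gaussianReal, mul_pow, sq_sqrt hs, div_mul_eq_mul_div]
    _ = ∫⁻ g, ∫⁻ ω, ENNReal.ofReal (exp (√s * U ω * g)) ∂P ∂gaussianReal 0 1 :=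
        lintegral_lintegral_swap ((measurable_exp.comp_aemeasurable
          ((hU.comp_fst.const_mul _).mul measurable_snd.aemeasurable)).ennreal_ofReal)
    _ ≤ _ := (lintegral_mono hmgf).trans_eq (lintegral_exp_mul_sq_gaussianReal hsc)

end GaussianIntegration

end SubGaussian

section IIDCopies

variable {ι Ω Ω' α β : Type*} [MeasurableSpace Ω] [MeasurableSpace Ω'] [MeasurableSpace α]
  [MeasurableSpace β] {P : Measure Ω} {P' : Measure Ω'} {V : Ω → α} {Vs : ι → Ω' → α}

/-- The random variables `Vs i`, defined on `(Ω', P')`, are independent copies of `V`, defined on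
`(Ω, P)`. -/
structure IsIIDCopies (P : Measure Ω) (V : Ω → α) (P' : Measure Ω') (Vs : ι → Ω' → α) :
    Prop where
  indep : iIndepFun Vs P'
  identDistrib : ∀ i, IdentDistrib (Vs i) V P' P

theorem IsIIDCopies.comp (h : IsIIDCopies P V P' Vs) {g : α → β} (hg : Measurable g) :
    IsIIDCopies P (fun ω => g (V ω)) P' (fun i ω => g (Vs i ω)) :=
  ⟨h.indep.comp (fun _ => g) fun _ => hg, fun i => (h.identDistrib i).comp hg⟩

theorem IsIIDCopies.ae_forall_mem [Countable ι] (h : IsIIDCopies P V P' Vs) {s : Set α}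
    (hs : MeasurableSet s) (hV : ∀ᵐ ω ∂P, V ω ∈ s) : ∀ᵐ ω ∂P', ∀ i, Vs i ω ∈ s :=
  ae_all_iff.2 fun i => (h.identDistrib i).symm.ae_snd hs hV

end IIDCopies

section Bernstein

open Real
open scoped NNReal

variable {ι Ω Ω' : Type*} [Fintype ι] [MeasurableSpace Ω] [MeasurableSpace Ω'] {P : Measure Ω}
  {P' : Measure Ω'}

theorem integrable_of_integrable_exp_abs {Y : Ω → ℝ} {θ : ℝ} (hθ : 0 < θ)
    (hY : AEStronglyMeasurable Y P) (hi : Integrable (fun ω => exp (θ * |Y ω|)) P) :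
    Integrable Y P := by
  refine (hi.const_mul θ⁻¹).mono' hY (ae_of_all _ fun ω => ?_)
  rw [norm_eq_abs, ← div_eq_inv_mul, le_div_iff₀' hθ]
  linarith [add_one_le_exp (θ * |Y ω|)]

theorem integrable_exp_mul_of_integrable_exp_abs {Y : Ω → ℝ} {θ l : ℝ}
    (hY : AEStronglyMeasurable Y P) (hi : Integrable (fun ω => exp (θ * |Y ω|)) P)
    (hl : |l| ≤ θ) : Integrable (fun ω => exp (l * Y ω)) P := by
  refine hi.mono' (continuous_exp.comp_aestronglyMeasurable (hY.const_mul l))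
    (ae_of_all _ fun ω => ?_)
  rw [norm_eq_abs, abs_of_pos (exp_pos _), exp_le_exp]
  calc l * Y ω ≤ |l| * |Y ω| := (le_abs_self _).trans (abs_mul _ _).le
    _ ≤ θ * |Y ω| := by gcongr

variable [IsProbabilityMeasure P]

theorem mgf_le_of_integral_exp_abs_le {Y : Ω → ℝ} {θ l K : ℝ} (hθ : 0 < θ)
    (hY : AEStronglyMeasurable Y P) (h0 : ∫ ω, Y ω ∂P = 0)
    (hi : Integrable (fun ω => exp (θ * |Y ω|)) P) (hK : ∫ ω, exp (θ * |Y ω|) ∂P ≤ K)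
    (hl : |l| ≤ θ / 2) : mgf Y P l ≤ exp (8 * K * l ^ 2 / θ ^ 2) := by
  have hlin : Integrable (fun ω => 1 + l * Y ω) P :=
    (integrable_const _).add ((integrable_of_integrable_exp_abs hθ hY hi).const_mul l)
  calc mgf Y P l ≤ ∫ ω, (1 + l * Y ω + 8 * l ^ 2 / θ ^ 2 * exp (θ * |Y ω|)) ∂P :=
        integral_mono (integrable_exp_mul_of_integrable_exp_abs hY hi (by linarith))
          (hlin.add (hi.const_mul _)) fun ω => exp_mul_le_one_add_add_mul_exp hθ hl (Y ω)
    _ = 8 * l ^ 2 / θ ^ 2 * (∫ ω, exp (θ * |Y ω|) ∂P) + 1 := by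
        rw [integral_add hlin (hi.const_mul _), integral_add (integrable_const _)
          ((integrable_of_integrable_exp_abs hθ hY hi).const_mul l), integral_const_mul,
          integral_const_mul, h0]
        simp [add_comm]
    _ ≤ 8 * K * l ^ 2 / θ ^ 2 + 1 := by
        rw [show 8 * K * l ^ 2 / θ ^ 2 = 8 * l ^ 2 / θ ^ 2 * K by ring]
        gcongr
    _ ≤ exp (8 * K * l ^ 2 / θ ^ 2) := add_one_le_exp _

theorem measureReal_sum_ge_le_exp [IsProbabilityMeasure P'] {Y : Ω → ℝ} {Ys : ι → Ω' → ℝ}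
    (hYs : IsIIDCopies P Y P' Ys) {l B t : ℝ} (hl : 0 ≤ l)
    (hi : Integrable (fun ω => exp (l * Y ω)) P) (hB : mgf Y P l ≤ exp B) :
    P'.real {ω | Fintype.card ι * t ≤ ∑ i, Ys i ω} ≤ exp (Fintype.card ι * (B - l * t)) := by
  have hmgf : mgf (∑ i, Ys i) P' l = mgf Y P l ^ Fintype.card ι := by
    rw [hYs.indep.mgf_sum₀ (fun i => (hYs.identDistrib i).aemeasurable_fst),
      Finset.prod_congr rfl fun i _ => congrFun (mgf_congr_identDistrib (hYs.identDistrib i)) l,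
      Finset.prod_const, Finset.card_univ]
  have hsum : Integrable (fun ω => exp (l * (∑ i, Ys i) ω)) P' := by
    by_contra hcon
    rw [mgf, integral_undef hcon] at hmgf
    exact (pow_pos (mgf_pos hi) _).ne hmgf
  calc P'.real {ω | Fintype.card ι * t ≤ ∑ i, Ys i ω}
      ≤ exp (-l * (Fintype.card ι * t)) * mgf Y P l ^ Fintype.card ι := by
        simpa only [Finset.sum_apply, hmgf] using
          measure_ge_le_exp_mul_mgf (X := ∑ i, Ys i) (μ := P') (Fintype.card ι * t) hl hsum
    _ ≤ exp (-l * (Fintype.card ι * t)) * exp B ^ Fintype.card ι := by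
        gcongr
        exact mgf_nonneg
    _ = exp (Fintype.card ι * (B - l * t)) := by
        rw [← exp_nat_mul, ← exp_add]
        ring_nf

/-- **Bernstein's inequality**, with the exponential parameter `l = θ² t / (16 K)` that balances
the two terms of the Chernoff exponent. -/
theorem measureReal_abs_sum_ge_le_exp [IsProbabilityMeasure P'] {Y : Ω → ℝ}
    {Ys : ι → Ω' → ℝ} (hYs : IsIIDCopies P Y P' Ys) {θ K t : ℝ} (hθ : 0 < θ) (hK : 0 < K)
    (hY : AEStronglyMeasurable Y P) (h0 : ∫ ω, Y ω ∂P = 0)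
    (hi : Integrable (fun ω => exp (θ * |Y ω|)) P) (hexp : ∫ ω, exp (θ * |Y ω|) ∂P ≤ K)
    (ht : 0 ≤ t) (ht' : θ * t ≤ 8 * K) :
    P'.real {ω | Fintype.card ι * t ≤ |∑ i, Ys i ω|} ≤
      2 * exp (-(Fintype.card ι * (θ ^ 2 * t ^ 2 / (32 * K)))) := by
  set l := θ ^ 2 * t / (16 * K) with hl
  have hl0 : 0 ≤ l := by positivity
  have hlθ : |l| ≤ θ / 2 := by
    rw [abs_of_nonneg hl0, hl, div_le_iff₀ (by positivity)]
    nlinarith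
  have hexponent : 8 * K * l ^ 2 / θ ^ 2 - l * t = -(θ ^ 2 * t ^ 2 / (32 * K)) := by
    rw [hl]; field_simp; ring
  have upper := measureReal_sum_ge_le_exp (t := t) hYs hl0
    (integrable_exp_mul_of_integrable_exp_abs hY hi (by linarith))
    (mgf_le_of_integral_exp_abs_le hθ hY h0 hi hexp hlθ)
  have lower := measureReal_sum_ge_le_exp (t := t) (hYs.comp measurable_neg) hl0
    (integrable_exp_mul_of_integrable_exp_abs hY.neg (by simpa using hi) (by linarith))
    (mgf_le_of_integral_exp_abs_le hθ hY.neg (by simp [integral_neg, h0]) (by simpa using hi)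
      (by simpa using hexp) hlθ)
  rw [hexponent, mul_neg] at upper lower
  have hcover : {ω | Fintype.card ι * t ≤ |∑ i, Ys i ω|} ⊆
      {ω | Fintype.card ι * t ≤ ∑ i, Ys i ω} ∪ {ω | Fintype.card ι * t ≤ ∑ i, -Ys i ω} :=
    fun ω hω => by
      simpa only [Set.mem_union, Set.mem_ofPred_eq, Finset.sum_neg_distrib] using le_abs.1 hω
  linarith [(measureReal_mono (μ := P') hcover).trans (measureReal_union_le _ _)]

end Bernstein

section SubGaussianProduct

open Real
open scoped NNReal

variable {Ω : Type*} [MeasurableSpace Ω] {P : Measure Ω}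

theorem exp_mul_abs_mul_le {θ : ℝ} (hθ : 0 ≤ θ) (u v : ℝ) :
    exp (θ * |u * v|) ≤ 1 / 2 * (exp (θ * u ^ 2) + exp (θ * v ^ 2)) := by
  have hamgm : |u * v| ≤ (u ^ 2 + v ^ 2) / 2 := by
    rw [abs_mul, ← sq_abs u, ← sq_abs v]
    linarith [two_mul_le_add_sq |u| |v|]
  have hconv := convexOn_exp.2 (Set.mem_univ (θ * u ^ 2)) (Set.mem_univ (θ * v ^ 2))
    (by norm_num : (0 : ℝ) ≤ 1 / 2) (by norm_num : (0 : ℝ) ≤ 1 / 2) (by norm_num)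
  simp only [smul_eq_mul] at hconv
  calc exp (θ * |u * v|) ≤ exp (1 / 2 * (θ * u ^ 2) + 1 / 2 * (θ * v ^ 2)) :=
        exp_le_exp.2 (by linarith [mul_le_mul_of_nonneg_left hamgm hθ])
    _ ≤ _ := by linarith

variable [IsProbabilityMeasure P]

theorem integrable_exp_sq_and_integral_le_two {U : Ω → ℝ} (hU : HasSubgaussianMGF U 1 P) :
    Integrable (fun ω => exp (3 / 8 * U ω ^ 2)) P ∧ ∫ ω, exp (3 / 8 * U ω ^ 2) ∂P ≤ 2 := by
  have hUm := hU.aemeasurable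
  have hsqrt : (√(1 - 3 / 4 * ((1 : ℝ≥0) : ℝ)))⁻¹ = 2 := by
    rw [← sqrt_inv, sqrt_eq_iff_mul_self_eq] <;> norm_num
  have hle : ∫⁻ ω, ENNReal.ofReal (exp (3 / 8 * U ω ^ 2)) ∂P ≤ ENNReal.ofReal 2 := by
    simpa only [hsqrt, show (3 / 4 : ℝ) / 2 = 3 / 8 by norm_num] using
      lintegral_exp_sq_le_of_hasSubgaussianMGF hU (s := 3 / 4) (by norm_num) (by norm_num)
  exact ⟨integrable_exp_of_lintegral_lt_top (by fun_prop) (hle.trans_lt ENNReal.ofReal_lt_top),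
    integral_exp_le_of_lintegral_le zero_le_two (by fun_prop) hle⟩

theorem integrable_exp_abs_mul_and_integral_le_two {U V : Ω → ℝ} (hU : HasSubgaussianMGF U 1 P)
    (hV : HasSubgaussianMGF V 1 P) :
    Integrable (fun ω => exp (3 / 8 * |U ω * V ω|)) P ∧
      ∫ ω, exp (3 / 8 * |U ω * V ω|) ∂P ≤ 2 := by
  obtain ⟨hUi, hU2⟩ := integrable_exp_sq_and_integral_le_two hU
  obtain ⟨hVi, hV2⟩ := integrable_exp_sq_and_integral_le_two hV
  have hdom := (hUi.add hVi).const_mul (1 / 2)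
  have hpt := fun ω => exp_mul_abs_mul_le (θ := 3 / 8) (by norm_num) (U ω) (V ω)
  have hUm := hU.aemeasurable
  have hVm := hV.aemeasurable
  have hi : Integrable (fun ω => exp (3 / 8 * |U ω * V ω|)) P := by
    refine hdom.mono' (AEMeasurable.aestronglyMeasurable (by fun_prop)) (ae_of_all _ fun ω => ?_)
    rw [norm_eq_abs, abs_of_pos (exp_pos _)]
    exact hpt ω
  refine ⟨hi, (integral_mono hi hdom hpt).trans ?_⟩
  simp only [Pi.add_apply]
  rw [integral_const_mul, integral_add hUi hVi]
  linarith

theorem integrable_exp_abs_sub_integral_and_integral_le {Y : Ω → ℝ} {θ K : ℝ} (hθ : 0 < θ)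
    (hY : AEStronglyMeasurable Y P) (hi : Integrable (fun ω => exp (θ * |Y ω|)) P)
    (hK : ∫ ω, exp (θ * |Y ω|) ∂P ≤ K) :
    Integrable (fun ω => exp (θ * |Y ω - ∫ ω, Y ω ∂P|)) P ∧
      ∫ ω, exp (θ * |Y ω - ∫ ω, Y ω ∂P|) ∂P ≤ exp (K - 1) * K := by
  have hmean : θ * |∫ ω, Y ω ∂P| ≤ K - 1 := by
    have hYi := integrable_of_integrable_exp_abs hθ hY hi
    have hle : ∫ ω, (θ * |Y ω| + 1) ∂P ≤ ∫ ω, exp (θ * |Y ω|) ∂P :=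
      integral_mono ((hYi.abs.const_mul θ).add (integrable_const _)) hi fun _ => add_one_le_exp _
    rw [integral_add (hYi.abs.const_mul θ) (integrable_const _), integral_const_mul] at hle
    simp only [integral_const, probReal_univ, one_smul] at hle
    linarith [mul_le_mul_of_nonneg_left (abs_integral_le_integral_abs (f := Y) (μ := P)) hθ.le]
  have hpt : ∀ ω, exp (θ * |Y ω - ∫ ω, Y ω ∂P|) ≤ exp (K - 1) * exp (θ * |Y ω|) := fun ω => by
    rw [← exp_add, exp_le_exp]
    linarith [mul_le_mul_of_nonneg_left (abs_sub (Y ω) (∫ ω, Y ω ∂P)) hθ.le]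
  have hint : Integrable (fun ω => exp (θ * |Y ω - ∫ ω, Y ω ∂P|)) P := by
    refine (hi.const_mul (exp (K - 1))).mono' (AEMeasurable.aestronglyMeasurable ?_)
      (ae_of_all _ fun ω => ?_)
    · have := hY.aemeasurable
      fun_prop
    · rw [norm_eq_abs, abs_of_pos (exp_pos _)]
      exact hpt ω
  refine ⟨hint, (integral_mono hint (hi.const_mul _) hpt).trans ?_⟩
  rw [integral_const_mul]
  gcongr

variable {ι Ω' : Type*} [Fintype ι] [MeasurableSpace Ω'] {P' : Measure Ω'}
  [IsProbabilityMeasure P']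

theorem measureReal_abs_sum_sub_integral_ge_le_exp {U V : Ω → ℝ} {Ys : ι → Ω' → ℝ}
    (hU : HasSubgaussianMGF U 1 P) (hV : HasSubgaussianMGF V 1 P)
    (hYs : IsIIDCopies P (fun ω => U ω * V ω) P' Ys) {τ : ℝ} (hτ : 0 ≤ τ) (hτ' : τ ≤ 128) :
    P'.real {ω | Fintype.card ι * τ ≤ |∑ i, (Ys i ω - ∫ ω, U ω * V ω ∂P)|} ≤
      2 * exp (-(Fintype.card ι * (3 * τ ^ 2 / 4096))) := by
  obtain ⟨hi, h2⟩ := integrable_exp_abs_mul_and_integral_le_two hU hV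
  have hmeas : AEStronglyMeasurable (fun ω => U ω * V ω) P :=
    (hU.aemeasurable.mul hV.aemeasurable).aestronglyMeasurable
  obtain ⟨hci, hc⟩ := integrable_exp_abs_sub_integral_and_integral_le (by norm_num) hmeas hi h2
  have hc6 : exp (2 - 1) * 2 ≤ 6 := by
    norm_num
    linarith [exp_one_lt_d9]
  have hUV := integrable_of_integrable_exp_abs (by norm_num) hmeas hi
  refine (measureReal_abs_sum_ge_le_exp (hYs.comp (measurable_id.sub_const _))
    (by norm_num : (0 : ℝ) < 3 / 8) (by norm_num : (0 : ℝ) < 6)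
    (hmeas.sub aestronglyMeasurable_const) ?_ hci (hc.trans hc6) hτ (by linarith)).trans_eq ?_
  · simp only [id]
    rw [integral_sub hUV (integrable_const _)]
    simp
  · ring_nf

/-- Scaling by `√(a b)` on the left allows vanishing proxies: the event is then null. -/
theorem measureReal_abs_sum_sub_integral_gt_le_exp {U V : Ω → ℝ}
    {Ys : ι → Ω' → ℝ} {a b : ℝ≥0} (hU : HasSubgaussianMGF U a P) (hV : HasSubgaussianMGF V b P)
    (hYs : IsIIDCopies P (fun ω => U ω * V ω) P' Ys) {τ : ℝ} (hτ : 0 ≤ τ) (hτ' : τ ≤ 128) :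
    P'.real {ω | Fintype.card ι * (√(a * b) * τ) < |∑ i, (Ys i ω - ∫ ω, U ω * V ω ∂P)|} ≤
      2 * exp (-(Fintype.card ι * (3 * τ ^ 2 / 4096))) := by
  by_cases hab : a = 0 ∨ b = 0
  · have hzero : (fun ω => U ω * V ω) =ᵐ[P] 0 := by
      rcases hab with rfl | rfl
      · filter_upwards [hU.ae_eq_zero_of_hasSubgaussianMGF_zero] with ω hω using by simp [hω]
      · filter_upwards [hV.ae_eq_zero_of_hasSubgaussianMGF_zero] with ω hω using by simp [hω]
    have hnull : P' {ω | Fintype.card ι * (√(a * b) * τ) <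
        |∑ i, (Ys i ω - ∫ ω, U ω * V ω ∂P)|} = 0 := by
      refine measure_mono_null (fun ω hω => ?_)
        (ae_iff.1 (hYs.ae_forall_mem (measurableSet_singleton 0) hzero))
      rw [Set.mem_ofPred_eq, integral_eq_zero_of_ae hzero] at hω
      refine fun hYω => hω.not_ge ?_
      simp only [Set.mem_singleton_iff.1 (hYω _), sub_zero, Finset.sum_const_zero, abs_zero]
      positivity
    rw [measureReal_def, hnull, ENNReal.toReal_zero]
    positivity
  obtain ⟨ha, hb⟩ := not_or.1 hab
  have hnormalize : ∀ {W : Ω → ℝ} {c : ℝ≥0}, c ≠ 0 → HasSubgaussianMGF W c P →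
      HasSubgaussianMGF (fun ω => (√c)⁻¹ * W ω) 1 P := fun {W c} hc hW => by
    refine hasSubgaussianMGF_const_mul hW (le_of_eq ?_)
    rw [inv_pow, sq_sqrt c.coe_nonneg, inv_mul_cancel₀ (by exact_mod_cast hc), NNReal.coe_one]
  have hprod : ∀ ω, (√a)⁻¹ * U ω * ((√b)⁻¹ * V ω) = (√(a * b))⁻¹ * (U ω * V ω) := fun ω => by
    rw [sqrt_mul a.coe_nonneg, mul_inv]; ring
  have hpos : 0 < √((a : ℝ) * b) := sqrt_pos.2 (by positivity)
  have hbase := measureReal_abs_sum_sub_integral_ge_le_exp (Ys := fun i ω =>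
    (√(a * b))⁻¹ * Ys i ω) (hnormalize ha hU) (hnormalize hb hV)
    (by simpa only [hprod] using hYs.comp (measurable_const_mul _)) hτ hτ'
  refine (measureReal_mono fun ω hω => ?_).trans hbase
  simp only [Set.mem_ofPred_eq, hprod, integral_const_mul, ← mul_sub, ← Finset.mul_sum, abs_mul,
    abs_inv, abs_of_pos hpos] at hω ⊢
  rw [← div_eq_inv_mul, le_div_iff₀ hpos]
  linarith

end SubGaussianProduct

section Net

open Metric Module
open scoped RealInnerProductSpace

theorem packingNumber_sphere_le (E : Type*) [NormedAddCommGroup E] [NormedSpace ℝ E]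
    [FiniteDimensional ℝ E] : packingNumber (1 / 2) (sphere (0 : E) 1) ≤ 5 ^ finrank ℝ E := by
  classical
  refine iSup₂_le fun C hC => iSup_le fun hsep => ?_
  by_contra! hcard
  obtain ⟨D, hDC, hD⟩ := Set.exists_subset_encard_eq (Order.add_one_le_of_lt hcard)
  obtain ⟨s, rfl⟩ := (Set.finite_of_encard_eq_coe
    (k := 5 ^ finrank ℝ E + 1) (by exact_mod_cast hD)).exists_finset_coe
  have hbound := Besicovitch.card_le_of_separated (s.image fun c => (2 : ℝ) • c) (by
    simp only [Finset.mem_image, forall_exists_index, and_imp, forall_apply_eq_imp_iff₂]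
    intro c hc
    rw [norm_smul, mem_sphere_zero_iff_norm.1 (hC (hDC hc))]
    norm_num) (by
    simp only [Finset.mem_image, forall_exists_index, and_imp, forall_apply_eq_imp_iff₂]
    intro c hc d hd hcd
    have hlt : _ < edist c d := hsep (hDC hc) (hDC hd) fun h => hcd (by rw [h])
    rw [edist_nndist, ENNReal.coe_lt_coe, ← NNReal.coe_lt_coe, coe_nndist, dist_eq_norm] at hlt
    rw [← smul_sub, norm_smul]
    norm_num at hlt ⊢
    linarith)
  rw [Finset.card_image_of_injective _ (smul_right_injective E two_ne_zero)] at hbound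
  rw [Set.encard_coe_eq_coe_finsetCard] at hD
  have : s.card = 5 ^ finrank ℝ E + 1 := by exact_mod_cast hD
  omega

theorem exists_finset_isCover_sphere (E : Type*) [NormedAddCommGroup E] [NormedSpace ℝ E]
    [FiniteDimensional ℝ E] : ∃ N : Finset E, N.card ≤ 5 ^ finrank ℝ E ∧
      (N : Set E) ⊆ sphere 0 1 ∧ IsCover (1 / 2) (sphere 0 1) (N : Set E) := by
  have hfin : packingNumber (1 / 2) (sphere (0 : E) 1) ≠ ⊤ :=
    ((packingNumber_sphere_le E).trans_lt (WithTop.coe_lt_top (5 ^ finrank ℝ E))).ne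
  have hle := (encard_maximalSeparatedSet hfin).trans_le (packingNumber_sphere_le E)
  obtain ⟨N, hN⟩ := (Set.finite_of_encard_le_coe
    (k := 5 ^ finrank ℝ E) (by exact_mod_cast hle)).exists_finset_coe
  rw [← hN, Set.encard_coe_eq_coe_finsetCard] at hle
  refine ⟨N, by exact_mod_cast hle, ?_, ?_⟩ <;> rw [hN]
  · exact maximalSeparatedSet_subset
  · exact isCover_maximalSeparatedSet hfin

variable {E : Type*} [NormedAddCommGroup E] [InnerProductSpace ℝ E]

theorem norm_sub_mul_norm_add_le {x u : E} (hx : ‖x‖ = 1) (hu : ‖u‖ = 1)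
    (hxu : ‖x - u‖ ≤ 1 / 2) : ‖x - u‖ * ‖x + u‖ ≤ 31 / 32 := by
  have hpar := parallelogram_law_with_norm ℝ x u
  rw [hx, hu] at hpar
  have hsq : ‖x - u‖ ^ 2 ≤ 1 / 4 := by nlinarith [norm_nonneg (x - u)]
  refine abs_le_of_sq_le_sq' ?_ (by norm_num) |>.2
  rw [mul_pow]
  nlinarith

theorem abs_inner_apply_self_le {T : E →L[ℝ] E} (hT : T.IsSymmetric) {x u : E} (hx : ‖x‖ = 1)
    (hu : ‖u‖ = 1) (hxu : ‖x - u‖ ≤ 1 / 2) : |⟪T x, x⟫| ≤ |⟪T u, u⟫| + 31 / 32 * ‖T‖ := by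
  have hpolar : ⟪T x, x⟫ = ⟪T u, u⟫ + ⟪T (x - u), x + u⟫ := by
    have hsymm : ⟪T u, x⟫ = ⟪T x, u⟫ := (hT u x).trans (real_inner_comm _ _)
    rw [map_sub, inner_sub_left, inner_add_right, inner_add_right, hsymm]
    ring
  rw [hpolar]
  refine (abs_add_le _ _).trans (add_le_add le_rfl ?_)
  calc |⟪T (x - u), x + u⟫| ≤ ‖T‖ * ‖x - u‖ * ‖x + u‖ :=
        (abs_real_inner_le_norm _ _).trans (by gcongr; exact T.le_opNorm _)
    _ ≤ 31 / 32 * ‖T‖ := by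
        rw [mul_assoc, mul_comm]
        gcongr
        exact norm_sub_mul_norm_add_le hx hu hxu

/-- Every unit vector is within `1 / 2` of the net, which costs at most `31 / 32 * ‖T‖` in the
quadratic form; as `‖T‖` is the supremum of the form, it can be absorbed on the left. -/
theorem norm_le_of_isCover_sphere {T : E →L[ℝ] E} (hT : T.IsSymmetric) {N : Set E}
    (hN : N ⊆ sphere 0 1) (hcover : IsCover (1 / 2) (sphere 0 1) N) {δ : ℝ} (hδ : 0 ≤ δ)
    (h : ∀ u ∈ N, |⟪T u, u⟫| ≤ δ) : ‖T‖ ≤ 32 * δ := by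
  have hunit : ∀ x : E, ‖x‖ = 1 → |⟪T x, x⟫| ≤ δ + 31 / 32 * ‖T‖ := fun x hx => by
    obtain ⟨u, hu, hxu⟩ := Set.mem_iUnion₂.1
      (isCover_iff_subset_iUnion_closedBall.1 hcover (mem_sphere_zero_iff_norm.2 hx))
    have hdist : ‖x - u‖ ≤ 1 / 2 := by simpa [dist_eq_norm] using hxu
    exact (abs_inner_apply_self_le hT hx (mem_sphere_zero_iff_norm.1 (hN hu)) hdist).trans
      (by gcongr; exact h u hu)
  have hrayleigh : ∀ x, |T.rayleighQuotient x| ≤ δ + 31 / 32 * ‖T‖ := fun x => by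
    rcases eq_or_ne x 0 with rfl | hx
    · simp only [ContinuousLinearMap.rayleighQuotient_apply_zero, abs_zero]
      positivity
    · have hnorm : ‖(‖x‖⁻¹ : ℝ) • x‖ = 1 := norm_smul_inv_norm (𝕜 := ℝ) hx
      rw [← T.rayleigh_smul x (inv_ne_zero (norm_ne_zero_iff.2 hx))]
      simpa [ContinuousLinearMap.rayleighQuotient, ContinuousLinearMap.reApplyInnerSelf, hnorm]
        using hunit _ hnorm
  have hle := (T.norm_eq_iSup_rayleighQuotient hT).trans_le (ciSup_le hrayleigh)
  linarith

open scoped Matrix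

theorem exists_finset_forall_abs_dotProduct_mulVec_le (p : ℕ) :
    ∃ N : Finset (Fin p → ℝ), N.card ≤ 5 ^ p ∧ (∀ u ∈ N, u ⬝ᵥ u = 1) ∧
      ∀ (B : Matrix (Fin p) (Fin p) ℝ) (δ : ℝ), B.IsSymm → 0 ≤ δ →
        (∀ u ∈ N, |u ⬝ᵥ B *ᵥ u| ≤ δ) → ∀ x, |x ⬝ᵥ B *ᵥ x| ≤ 32 * δ * (x ⬝ᵥ x) := by
  have hself : ∀ x : EuclideanSpace ℝ (Fin p), x.ofLp ⬝ᵥ x.ofLp = ‖x‖ ^ 2 := fun x => by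
    rw [EuclideanSpace.real_norm_sq_eq]
    simp only [dotProduct, sq]
  obtain ⟨N, hcard, hN, hcover⟩ := exists_finset_isCover_sphere (EuclideanSpace ℝ (Fin p))
  rw [finrank_euclideanSpace_fin] at hcard
  refine ⟨N.image WithLp.ofLp, Finset.card_image_le.trans hcard, ?_, fun B δ hB hδ h x => ?_⟩
  · simp only [Finset.mem_image, forall_exists_index, and_imp, forall_apply_eq_imp_iff₂]
    intro u hu
    rw [hself, mem_sphere_zero_iff_norm.1 (hN hu), one_pow]
  · set T := Matrix.toEuclideanCLM (n := Fin p) (𝕜 := ℝ) B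
    have hT : T.IsSymmetric := Matrix.isSymmetric_toEuclideanLin_iff.2
      ((Matrix.conjTranspose_eq_transpose_of_trivial B).trans hB)
    have hform : ∀ u : EuclideanSpace ℝ (Fin p), ⟪T u, u⟫ = u.ofLp ⬝ᵥ B *ᵥ u.ofLp := fun u => by
      rw [real_inner_comm, Matrix.inner_toEuclideanCLM]
    have hnorm := norm_le_of_isCover_sphere hT hN hcover hδ fun u hu => by
      rw [hform]
      exact h _ (Finset.mem_image_of_mem _ hu)
    calc |x ⬝ᵥ B *ᵥ x| = |⟪T (WithLp.toLp 2 x), WithLp.toLp 2 x⟫| := by rw [hform]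
      _ ≤ ‖T‖ * ‖WithLp.toLp 2 x‖ * ‖WithLp.toLp 2 x‖ :=
          (abs_real_inner_le_norm _ _).trans (by gcongr; exact T.le_opNorm _)
      _ ≤ 32 * δ * (x ⬝ᵥ x) := by
          rw [mul_assoc, ← sq, ← hself, hself]
          gcongr

end Net

section Covariance

open scoped NNReal Matrix

variable {ι Ω Ω' : Type*} [Fintype ι] [MeasurableSpace Ω] [MeasurableSpace Ω'] {P : Measure Ω}
  [IsProbabilityMeasure P] {P' : Measure Ω'} [IsProbabilityMeasure P']

theorem dotProduct_sum_vecMulVec_sub_mulVec {p : ℕ} (w : ι → Fin p → ℝ)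
    (S : Matrix (Fin p) (Fin p) ℝ) (x : Fin p → ℝ) :
    x ⬝ᵥ (∑ i, Matrix.vecMulVec (w i) (w i) - (Fintype.card ι : ℝ) • S) *ᵥ x =
      ∑ i, ((x ⬝ᵥ w i) ^ 2 - sqNormOf S x) := by
  rw [Matrix.sub_mulVec, dotProduct_sub, Matrix.sum_mulVec, dotProduct_sum, Matrix.smul_mulVec,
    dotProduct_smul, Finset.sum_sub_distrib, Finset.sum_const, Finset.card_univ, nsmul_eq_mul,
    smul_eq_mul, sqNormOf]
  congr 1
  refine Finset.sum_congr rfl fun i _ => ?_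
  rw [Matrix.vecMulVec_mulVec, dotProduct_comm (w i)]
  simp [dotProduct_smul, sq]

theorem measureReal_exists_abs_sum_sq_sub_gt_le_exp {p : ℕ} {W : Ω → Fin p → ℝ}
    {Ws : ι → Ω' → Fin p → ℝ} (hWs : IsIIDCopies P W P' Ws) {c : ℝ≥0}
    (hW : ∀ u, u ⬝ᵥ u = 1 → HasSubgaussianMGF (fun ω => u ⬝ᵥ W ω) c P)
    {S : Matrix (Fin p) (Fin p) ℝ} (hS : S.IsSymm)
    (hsq : ∀ u, ∫ ω, (u ⬝ᵥ W ω) ^ 2 ∂P = sqNormOf S u) {τ : ℝ} (hτ : 0 ≤ τ) (hτ' : τ ≤ 128) :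
    P'.real {ω | ∃ x, 32 * (Fintype.card ι * (c * τ)) * (x ⬝ᵥ x) <
        |∑ i, ((x ⬝ᵥ Ws i ω) ^ 2 - sqNormOf S x)|} ≤
      5 ^ p * (2 * Real.exp (-(Fintype.card ι * (3 * τ ^ 2 / 4096)))) := by
  obtain ⟨N, hcard, hN1, hN⟩ := exists_finset_forall_abs_dotProduct_mulVec_le p
  have hcover : {ω | ∃ x, 32 * (Fintype.card ι * (c * τ)) * (x ⬝ᵥ x) <
        |∑ i, ((x ⬝ᵥ Ws i ω) ^ 2 - sqNormOf S x)|} ⊆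
      ⋃ u ∈ N, {ω | Fintype.card ι * (√(c * c) * τ) <
        |∑ i, ((u ⬝ᵥ Ws i ω) * (u ⬝ᵥ Ws i ω) - ∫ ω, (u ⬝ᵥ W ω) * (u ⬝ᵥ W ω) ∂P)|} := by
    rintro ω ⟨x, hx⟩
    by_contra! hnet
    simp only [Set.mem_iUnion, Set.mem_ofPred_eq, not_exists, not_lt, ← sq, hsq,
      Real.sqrt_sq c.coe_nonneg] at hnet
    have hsymm : (∑ i, Matrix.vecMulVec (Ws i ω) (Ws i ω) - (Fintype.card ι : ℝ) • S).IsSymm := by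
      refine Matrix.IsSymm.sub ?_ (hS.smul _)
      simp only [Matrix.IsSymm, Matrix.transpose_sum, Matrix.transpose_vecMulVec]
    have := hN _ (Fintype.card ι * (c * τ)) hsymm (by positivity) (fun u hu => by
      rw [dotProduct_sum_vecMulVec_sub_mulVec]; exact hnet u hu) x
    rw [dotProduct_sum_vecMulVec_sub_mulVec] at this
    exact this.not_gt hx
  have hpoint : ∀ u ∈ N, P'.real {ω | Fintype.card ι * (√(c * c) * τ) <
        |∑ i, ((u ⬝ᵥ Ws i ω) * (u ⬝ᵥ Ws i ω) - ∫ ω, (u ⬝ᵥ W ω) * (u ⬝ᵥ W ω) ∂P)|} ≤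
      2 * Real.exp (-(Fintype.card ι * (3 * τ ^ 2 / 4096))) := fun u hu =>
    measureReal_abs_sum_sub_integral_gt_le_exp (hW u (hN1 u hu)) (hW u (hN1 u hu))
      (hWs.comp (g := fun w => (u ⬝ᵥ w) * (u ⬝ᵥ w)) (by fun_prop)) hτ hτ'
  calc _ ≤ ∑ u ∈ N, _ := (measureReal_mono hcover (measure_ne_top _ _)).trans
        (measureReal_biUnion_finset_le _ _)
    _ ≤ N.card • _ := Finset.sum_le_card_nsmul _ _ _ hpoint
    _ ≤ _ := by
        rw [nsmul_eq_mul]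
        gcongr
        exact_mod_cast hcard

end Covariance

section Spectral

open scoped Matrix

variable {d m k : ℕ}

theorem isHermitian_iff_isSymm {Q : Matrix (Fin d) (Fin d) ℝ} : Q.IsHermitian ↔ Q.IsSymm := by
  rw [Matrix.IsHermitian, Matrix.conjTranspose_eq_transpose_of_trivial, Matrix.IsSymm]

theorem dotProduct_mulVec_eq_transpose_mulVec_dotProduct (B : Matrix (Fin m) (Fin k) ℝ)
    (x : Fin m → ℝ) (y : Fin k → ℝ) : x ⬝ᵥ B *ᵥ y = Bᵀ *ᵥ x ⬝ᵥ y := by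
  rw [Matrix.dotProduct_mulVec, Matrix.mulVec_transpose]

theorem isUnit_of_rank_eq {B : Matrix (Fin d) (Fin d) ℝ} (h : B.rank = d) : IsUnit B := by
  rw [← Matrix.mulVec_surjective_iff_isUnit]
  exact LinearMap.range_eq_top.1 (Submodule.eq_top_of_finrank_eq
    (h.trans (Module.finrank_fin_fun ℝ).symm))

theorem exists_orthogonal_mul_diagonal_mul_transpose {Q : Matrix (Fin d) (Fin d) ℝ}
    (hQ : Q.IsHermitian) : ∃ U : Matrix (Fin d) (Fin d) ℝ,
      Uᵀ * U = 1 ∧ Q = U * Matrix.diagonal hQ.eigenvalues * Uᵀ := by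
  refine ⟨hQ.eigenvectorUnitary, ?_, ?_⟩
  · simpa [Matrix.star_eq_conjTranspose] using Unitary.coe_star_mul_self hQ.eigenvectorUnitary
  · simpa [Unitary.conjStarAlgAut_apply, Matrix.star_eq_conjTranspose, Function.comp_def]
      using hQ.spectral_theorem

theorem eigenvalues₀_nonneg {Q : Matrix (Fin d) (Fin d) ℝ} (hQ : Q.PosSemidef)
    (j : Fin (Fintype.card (Fin d))) : 0 ≤ hQ.1.eigenvalues₀ j := by
  have h := hQ.eigenvalues_nonneg (Fintype.equivOfCardEq (Fintype.card_fin _) j)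
  rwa [Matrix.IsHermitian.eigenvalues, Equiv.symm_apply_apply] at h

/-- The nonzero eigenvalues come first in the decreasing enumeration, and there are `Q.rank` of
them. -/
theorem eigenvalues₀_ne_zero_iff {Q : Matrix (Fin d) (Fin d) ℝ} (hQ : Q.PosSemidef)
    (j : Fin (Fintype.card (Fin d))) : hQ.1.eigenvalues₀ j ≠ 0 ↔ (j : ℕ) < Q.rank := by
  set s : Finset (Fin (Fintype.card (Fin d))) := {j | hQ.1.eigenvalues₀ j ≠ 0} with hs
  have hcard : s.card = Q.rank := by
    rw [hQ.1.rank_eq_card_non_zero_eigs, ← Fintype.card_subtype]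
    exact Fintype.card_congr ((Fintype.equivOfCardEq (Fintype.card_fin _)).subtypeEquiv
      fun j => by rw [Matrix.IsHermitian.eigenvalues, Equiv.symm_apply_apply])
  have hlower : ∀ i ≤ j, hQ.1.eigenvalues₀ j ≠ 0 → i ∈ s := fun i hij hj => by
    simp only [hs, Finset.mem_filter_univ]
    exact (((eigenvalues₀_nonneg hQ j).lt_of_ne' hj).trans_le (hQ.1.eigenvalues₀_antitone hij)).ne'
  rw [← hcard]
  constructor
  · intro hj
    have := Finset.card_le_card fun i hi => hlower i (Finset.mem_Iic.1 hi) hj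
    rwa [Fin.card_Iic] at this
  · intro hj hzero
    have : s ⊆ Finset.Iio j := fun i hi => by
      rw [Finset.mem_Iio]
      by_contra! hji
      simp only [hs, Finset.mem_filter_univ] at hi
      exact hi (le_antisymm ((hQ.1.eigenvalues₀_antitone hji).trans_eq hzero)
        (eigenvalues₀_nonneg hQ i))
    have := Finset.card_le_card this
    rw [Fin.card_Iio] at this
    omega

theorem ordEig_eq {Q : Matrix (Fin d) (Fin d) ℝ} (hQ : Q.IsHermitian) {k : ℕ} (h1 : 1 ≤ k)
    (hk : k ≤ d) :
    ordEig Q k = hQ.eigenvalues₀ ⟨k - 1, by rw [Fintype.card_fin]; omega⟩ := by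
  rw [ordEig, dif_pos ⟨hQ, h1, hk⟩]

theorem ordEig_rank_pos {Q : Matrix (Fin d) (Fin d) ℝ} (hQ : Q.PosSemidef) (h : Q.rank ≠ 0) :
    0 < ordEig Q Q.rank := by
  have hk : Q.rank ≤ d := by simpa using Q.rank_le_width
  rw [ordEig_eq hQ.1 (Nat.one_le_iff_ne_zero.2 h) hk]
  refine (eigenvalues₀_nonneg hQ _).lt_of_ne' ((eigenvalues₀_ne_zero_iff hQ _).2 ?_)
  simp only
  omega

theorem ordEig_rank_le_eigenvalues {Q : Matrix (Fin d) (Fin d) ℝ} (hQ : Q.PosSemidef) {i : Fin d}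
    (hi : hQ.1.eigenvalues i ≠ 0) : ordEig Q Q.rank ≤ hQ.1.eigenvalues i := by
  have hlt := (eigenvalues₀_ne_zero_iff hQ _).1 hi
  have hk : Q.rank ≤ d := by simpa using Q.rank_le_width
  rw [ordEig_eq hQ.1 (by omega) hk]
  exact hQ.1.eigenvalues₀_antitone (Fin.le_def.2 (Nat.le_sub_one_of_lt hlt))

theorem ordEig_rank_mul_dotProduct_le {Q : Matrix (Fin d) (Fin d) ℝ} (hQ : Q.PosSemidef)
    (w : Fin d → ℝ) : ordEig Q Q.rank * (Q *ᵥ w ⬝ᵥ Q *ᵥ w) ≤ sqNormOf Q (Q *ᵥ w) := by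
  obtain ⟨U, hU, hUd⟩ := exists_orthogonal_mul_diagonal_mul_transpose hQ.1
  set D := Matrix.diagonal hQ.1.eigenvalues with hD
  have hcoord : ∀ x, Uᵀ *ᵥ Q *ᵥ x = D *ᵥ Uᵀ *ᵥ x := fun x => by
    conv_lhs => rw [hUd]
    simp only [Matrix.mulVec_mulVec, ← Matrix.mul_assoc, hU, Matrix.one_mul]
  have hisom : ∀ x y, x ⬝ᵥ y = Uᵀ *ᵥ x ⬝ᵥ Uᵀ *ᵥ y := fun x y => by
    rw [← dotProduct_mulVec_eq_transpose_mulVec_dotProduct, Matrix.mulVec_mulVec,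
      mul_eq_one_comm.1 hU, Matrix.one_mulVec]
  rw [sqNormOf, hisom (Q *ᵥ w), hisom (Q *ᵥ w), hcoord (Q *ᵥ w), hcoord w, hD]
  simp only [dotProduct, Matrix.mulVec_diagonal, Finset.mul_sum]
  refine Finset.sum_le_sum fun i _ => ?_
  by_cases hi : hQ.1.eigenvalues i = 0
  · simp [hi]
  · rw [mul_left_comm]
    nlinarith [mul_le_mul_of_nonneg_right (ordEig_rank_le_eigenvalues hQ hi)
      (mul_self_nonneg (hQ.1.eigenvalues i * (Uᵀ *ᵥ w) i))]

theorem one_le_condNumber {Q : Matrix (Fin d) (Fin d) ℝ} (hQ : Q.PosSemidef) (h0 : Q ≠ 0) :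
    1 ≤ condNumber Q := by
  have hrank : Q.rank ≠ 0 := fun hrank => h0 (hQ.1.eigenvalues_eq_zero_iff.1 (funext fun i =>
    by_contra fun hi => Nat.not_lt_zero _ (hrank ▸ (eigenvalues₀_ne_zero_iff hQ _).1 hi)))
  have hk : Q.rank ≤ d := by simpa using Q.rank_le_width
  have hanti : ∀ {i j : ℕ}, 1 ≤ i → i ≤ j → j ≤ d → ordEig Q j ≤ ordEig Q i := fun hi hij hj => by
    rw [ordEig_eq hQ.1 hi (hij.trans hj), ordEig_eq hQ.1 (hi.trans hij) hj]
    exact hQ.1.eigenvalues₀_antitone (Fin.le_def.2 (Nat.sub_le_sub_right hij 1))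
  have hpos : 0 < ordEig Q 1 := (ordEig_rank_pos hQ hrank).trans_le (hanti le_rfl (by omega) hk)
  rw [condNumber, ENNReal.le_div_iff_mul_le (Or.inr (by simpa using hpos)) (Or.inl (by simp)),
    one_mul]
  exact ENNReal.ofReal_le_ofReal (hanti le_rfl (by omega) le_rfl)

theorem opNorm_pos {Q : Matrix (Fin d) (Fin d) ℝ} (hQ : Q ≠ 0) : 0 < opNorm Q :=
  norm_pos_iff.2 ((map_ne_zero_iff _ (Matrix.toEuclideanCLM (n := Fin d) (𝕜 := ℝ)).injective).2 hQ)

theorem sqNormOf_le_opNorm_mul (Q : Matrix (Fin d) (Fin d) ℝ) (v : Fin d → ℝ) :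
    sqNormOf Q v ≤ opNorm Q * (v ⬝ᵥ v) := by
  set T := Matrix.toEuclideanCLM (n := Fin d) (𝕜 := ℝ) Q
  set x : EuclideanSpace ℝ (Fin d) := WithLp.toLp 2 v
  calc sqNormOf Q v = inner ℝ x (T x) := (Matrix.inner_toEuclideanCLM Q x x).symm
    _ ≤ ‖x‖ * (‖T‖ * ‖x‖) := (real_inner_le_norm _ _).trans (by gcongr; exact T.le_opNorm x)
    _ = opNorm Q * (v ⬝ᵥ v) := by
        rw [mul_left_comm, ← sq, EuclideanSpace.real_norm_sq_eq]
        simp only [dotProduct, sq]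
        rfl

section FactorMatrix

variable {p K : ℕ} {A : Matrix (Fin p) (Fin K) ℝ} {S : Matrix (Fin K) (Fin K) ℝ}

theorem isUnit_transpose_mul_mul_mul_transpose_mul (hA : A.rank = K) (hS : S.rank = K) :
    IsUnit (Aᵀ * (A * S * Aᵀ) * A) := by
  have hgram : IsUnit (Aᵀ * A) := isUnit_of_rank_eq (by rw [Matrix.rank_transpose_mul_self, hA])
  simpa only [Matrix.mul_assoc] using (hgram.mul (isUnit_of_rank_eq hS)).mul hgram

theorem rank_mul_mul_transpose (hA : A.rank = K) (hS : S.rank = K) : (A * S * Aᵀ).rank = K := by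
  refine le_antisymm ?_ ?_
  · rw [Matrix.mul_assoc]
    exact (Matrix.rank_mul_le_left _ _).trans hA.le
  · calc K = (Aᵀ * (A * S * Aᵀ) * A).rank := by
          rw [Matrix.rank_of_isUnit _ (isUnit_transpose_mul_mul_mul_transpose_mul hA hS),
            Fintype.card_fin]
      _ ≤ (A * S * Aᵀ).rank :=
          (Matrix.rank_mul_le_left _ _).trans (Matrix.rank_mul_le_right _ _)

theorem posSemidef_mul_mul_transpose (hS : S.PosSemidef) : (A * S * Aᵀ).PosSemidef := by
  simpa using hS.mul_mul_conjTranspose_same A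

theorem ordEig_mul_mul_transpose_pos (hS : S.PosSemidef) (hA : A.rank = K) (hSr : S.rank = K)
    (hK : 1 ≤ K) : 0 < ordEig (A * S * Aᵀ) K := by
  have h := ordEig_rank_pos (posSemidef_mul_mul_transpose (A := A) hS)
  rw [rank_mul_mul_transpose hA hSr] at h
  exact h (by omega)

theorem exists_transpose_mulVec_eq_and_ordEig_mul_le (hS : S.PosSemidef) (hA : A.rank = K)
    (hSr : S.rank = K) (β : Fin K → ℝ) :
    ∃ v, Aᵀ *ᵥ v = β ∧ ordEig (A * S * Aᵀ) K * (v ⬝ᵥ v) ≤ sqNormOf S β := by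
  obtain ⟨w, hw⟩ := Matrix.mulVec_surjective_iff_isUnit.2
    (isUnit_transpose_mul_mul_mul_transpose_mul hA hSr) β
  rw [← Matrix.mulVec_mulVec, ← Matrix.mulVec_mulVec] at hw
  have hle := ordEig_rank_mul_dotProduct_le (posSemidef_mul_mul_transpose (A := A) hS) (A *ᵥ w)
  rw [rank_mul_mul_transpose hA hSr] at hle
  refine ⟨_, hw, hle.trans_eq ?_⟩
  rw [← hw, sqNormOf, sqNormOf, ← dotProduct_mulVec_eq_transpose_mulVec_dotProduct]
  simp only [Matrix.mulVec_mulVec, Matrix.mul_assoc]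

end FactorMatrix

section SquareRoot

variable {Q : Matrix (Fin d) (Fin d) ℝ}

open scoped MatrixOrder in
theorem psdSqrt_mul_self (hQ : Q.PosSemidef) : psdSqrt Q * psdSqrt Q = Q :=
  CFC.sqrt_mul_sqrt_self Q hQ.nonneg

open scoped MatrixOrder in
theorem isSymm_psdSqrt (Q : Matrix (Fin d) (Fin d) ℝ) : (psdSqrt Q).IsSymm :=
  isHermitian_iff_isSymm.1 (Matrix.nonneg_iff_posSemidef.1 (CFC.sqrt_nonneg Q)).1

theorem sqNormOf_eq_psdSqrt_mulVec_dotProduct (hQ : Q.PosSemidef) (v : Fin d → ℝ) :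
    sqNormOf Q v = psdSqrt Q *ᵥ v ⬝ᵥ psdSqrt Q *ᵥ v := by
  conv_lhs => rw [sqNormOf, ← psdSqrt_mul_self hQ, ← Matrix.mulVec_mulVec,
    dotProduct_mulVec_eq_transpose_mulVec_dotProduct, (isSymm_psdSqrt Q).eq]

theorem sqNormOf_nonneg (hQ : Q.PosSemidef) (v : Fin d → ℝ) : 0 ≤ sqNormOf Q v := by
  simpa [sqNormOf] using hQ.dotProduct_mulVec_nonneg v

end SquareRoot

section PseudoInverse

theorem isSymm_pinv {S : Matrix (Fin d) (Fin d) ℝ} (hS : S.IsSymm) : (pinv S).IsSymm := by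
  obtain ⟨h1, h2, h3, h4⟩ := pinv_spec S
  refine IsMoorePenrose.unique (B := S) ⟨?_, ?_, ?_, ?_⟩ (pinv_spec S)
  · simpa [Matrix.transpose_mul, hS.eq, Matrix.mul_assoc] using congrArg Matrix.transpose h1
  · simpa [Matrix.transpose_mul, hS.eq, Matrix.mul_assoc] using congrArg Matrix.transpose h2
  · have h : S * (pinv S)ᵀ = pinv S * S := by
      simpa [Matrix.transpose_mul, hS.eq] using h4.eq
    rwa [h]
  · have h : (pinv S)ᵀ * S = S * pinv S := by
      simpa [Matrix.transpose_mul, hS.eq] using h3.eq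
    rwa [h]

end PseudoInverse

end Spectral

section CovarianceMatrix

open scoped Matrix

variable {Ω : Type*} [MeasurableSpace Ω] {P : Measure Ω} {d : ℕ} {V : Ω → Fin d → ℝ}

theorem memLp_dotProduct (hV : ∀ j, MemLp (fun ω => V ω j) 2 P) (v : Fin d → ℝ) :
    MemLp (fun ω => v ⬝ᵥ V ω) 2 P :=
  memLp_finsetSum _ fun j _ => (hV j).const_mul (v j)

variable [IsProbabilityMeasure P]

theorem integral_dotProduct_eq_zero (hV : ∀ j, MemLp (fun ω => V ω j) 2 P)
    (h0 : ∀ j, ∫ ω, V ω j ∂P = 0) (v : Fin d → ℝ) : ∫ ω, v ⬝ᵥ V ω ∂P = 0 := by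
  simp only [dotProduct]
  rw [integral_finsetSum _ fun j _ => ((hV j).integrable one_le_two).const_mul (v j)]
  simp [integral_const_mul, h0]

theorem variance_dotProduct (hV : ∀ j, MemLp (fun ω => V ω j) 2 P) (v : Fin d → ℝ) :
    Var[fun ω => v ⬝ᵥ V ω; P] = sqNormOf (covMat P V) v := by
  rw [← covariance_self (memLp_dotProduct hV v).aemeasurable]
  simp only [dotProduct]
  rw [covariance_fun_sum_fun_sum (fun j => (hV j).const_mul (v j))
    (fun j => (hV j).const_mul (v j))]
  simp only [sqNormOf, dotProduct, Matrix.mulVec, covMat, Matrix.of_apply, Finset.mul_sum,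
    covariance_const_mul_left, covariance_const_mul_right]
  exact Finset.sum_congr rfl fun i _ => Finset.sum_congr rfl fun j _ => by ring

theorem integral_dotProduct_sq (hV : ∀ j, MemLp (fun ω => V ω j) 2 P)
    (h0 : ∀ j, ∫ ω, V ω j ∂P = 0) (v : Fin d → ℝ) :
    ∫ ω, (v ⬝ᵥ V ω) ^ 2 ∂P = sqNormOf (covMat P V) v := by
  rw [← variance_dotProduct hV, variance_of_integral_eq_zero (memLp_dotProduct hV v).aemeasurable
    (integral_dotProduct_eq_zero hV h0 v)]

theorem covMat_posSemidef (hV : ∀ j, MemLp (fun ω => V ω j) 2 P) : (covMat P V).PosSemidef := by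
  refine Matrix.posSemidef_iff_dotProduct_mulVec.2 ⟨?_, fun x => ?_⟩
  · ext i j
    simp [covMat, covariance_comm]
  · rw [star_trivial, ← sqNormOf, ← variance_dotProduct hV]
    exact variance_nonneg _ _

end CovarianceMatrix

section Whitening

open scoped Matrix

variable {d : ℕ} {Q : Matrix (Fin d) (Fin d) ℝ}

/-- The whitened vector `Q^{-1/2} x`; the inverse is the pseudo-inverse, as `Q` may be singular. -/
noncomputable def whiten (Q : Matrix (Fin d) (Fin d) ℝ) (x : Fin d → ℝ) : Fin d → ℝ :=
  pinv (psdSqrt Q) *ᵥ x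

theorem measurable_whiten (Q : Matrix (Fin d) (Fin d) ℝ) : Measurable (whiten Q) :=
  (Continuous.matrix_mulVec continuous_const continuous_id).measurable

theorem dotProduct_whiten (Q : Matrix (Fin d) (Fin d) ℝ) (u x : Fin d → ℝ) :
    u ⬝ᵥ whiten Q x = whiten Q u ⬝ᵥ x := by
  rw [whiten, dotProduct_mulVec_eq_transpose_mulVec_dotProduct,
    (isSymm_pinv (isSymm_psdSqrt Q)).eq, whiten]

theorem sqNormOf_mul_mul_pinv_psdSqrt (Q : Matrix (Fin d) (Fin d) ℝ) (u : Fin d → ℝ) :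
    sqNormOf (pinv (psdSqrt Q) * Q * pinv (psdSqrt Q)) u = sqNormOf Q (whiten Q u) := by
  rw [sqNormOf, ← Matrix.mulVec_mulVec, ← Matrix.mulVec_mulVec]
  exact dotProduct_whiten Q u _

theorem psdSqrt_mulVec_whiten_psdSqrt_mulVec (Q : Matrix (Fin d) (Fin d) ℝ) (b : Fin d → ℝ) :
    psdSqrt Q *ᵥ whiten Q (psdSqrt Q *ᵥ b) = psdSqrt Q *ᵥ b := by
  rw [whiten, Matrix.mulVec_mulVec, Matrix.mulVec_mulVec,
    (pinv_spec (psdSqrt Q)).mul_mul_self]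

theorem sqNormOf_whiten_psdSqrt_mulVec (hQ : Q.PosSemidef) (b : Fin d → ℝ) :
    sqNormOf Q (whiten Q (psdSqrt Q *ᵥ b)) = sqNormOf Q b := by
  rw [sqNormOf_eq_psdSqrt_mulVec_dotProduct hQ, psdSqrt_mulVec_whiten_psdSqrt_mulVec,
    ← sqNormOf_eq_psdSqrt_mulVec_dotProduct hQ]

theorem sqNormOf_sub_whiten_psdSqrt_mulVec (hQ : Q.PosSemidef) (b : Fin d → ℝ) :
    sqNormOf Q (b - whiten Q (psdSqrt Q *ᵥ b)) = 0 := by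
  rw [sqNormOf_eq_psdSqrt_mulVec_dotProduct hQ, Matrix.mulVec_sub,
    psdSqrt_mulVec_whiten_psdSqrt_mulVec, sub_self, zero_dotProduct]

/-- The map `u ↦ Q^{1/2} (whiten Q u)` is an orthogonal projection. -/
theorem sqNormOf_whiten_le (hQ : Q.PosSemidef) (u : Fin d → ℝ) :
    sqNormOf Q (whiten Q u) ≤ u ⬝ᵥ u := by
  obtain ⟨hmul, -, hsymm, -⟩ := pinv_spec (psdSqrt Q)
  rw [sqNormOf_eq_psdSqrt_mulVec_dotProduct hQ, whiten, Matrix.mulVec_mulVec]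
  set R := psdSqrt Q * pinv (psdSqrt Q)
  have hproj : u ⬝ᵥ R *ᵥ u = R *ᵥ u ⬝ᵥ R *ᵥ u := by
    rw [dotProduct_mulVec_eq_transpose_mulVec_dotProduct R (R *ᵥ u), hsymm.eq,
      Matrix.mulVec_mulVec, show R * R = R by rw [← Matrix.mul_assoc, hmul], dotProduct_comm]
  have hnonneg : 0 ≤ (u - R *ᵥ u) ⬝ᵥ (u - R *ᵥ u) := by
    simpa using dotProduct_self_star_nonneg (u - R *ᵥ u)
  rw [sub_dotProduct, dotProduct_sub, dotProduct_sub, dotProduct_comm (R *ᵥ u) u, hproj] at hnonneg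
  linarith

end Whitening

section SubGaussianVector

open scoped Matrix NNReal

variable {Ω : Type*} [MeasurableSpace Ω] {P : Measure Ω} {d : ℕ} {V : Ω → Fin d → ℝ} {c : ℝ≥0}

theorem integral_eq_zero_of_hasSubgaussianMGF [IsProbabilityMeasure P] {U : Ω → ℝ}
    (h : HasSubgaussianMGF U c P) : ∫ ω, U ω ∂P = 0 := by
  have hmin : IsLocalMin (fun t => Real.exp (c * t ^ 2 / 2) - mgf U P t) 0 :=
    .of_forall fun t => by simpa using h.mgf_le t
  have hexp : HasDerivAt (fun t : ℝ => Real.exp (c * t ^ 2 / 2)) 0 0 := by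
    simpa using ((((hasDerivAt_id (0 : ℝ)).pow 2).const_mul (c : ℝ)).div_const 2).exp
  have hmgf := hasDerivAt_mgf (X := U) (μ := P) (t := 0) (by simp [h.integrableExpSet_eq_univ])
  simpa using hmin.hasDerivAt_eq_zero (hexp.sub hmgf)

theorem sum_dotProduct_mul_sq_le {ι : Type*} [Fintype ι] {W : ι → Fin d → ℝ} {e : ι → ℝ}
    {r : ℝ} (h : ∀ j, |∑ i, W i j * e i| ≤ r) (x : Fin d → ℝ) :
    (∑ i, (x ⬝ᵥ W i) * e i) ^ 2 ≤ d * r ^ 2 * (x ⬝ᵥ x) := by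
  have hswap : ∑ i, (x ⬝ᵥ W i) * e i = ∑ j, x j * ∑ i, W i j * e i := by
    simp only [dotProduct, Finset.sum_mul, Finset.mul_sum, mul_assoc]
    exact Finset.sum_comm
  have hsq : ∑ j, (∑ i, W i j * e i) ^ 2 ≤ d * r ^ 2 := by
    simpa using Finset.sum_le_card_nsmul Finset.univ _ _ fun j _ => sq_le_sq' (abs_le.1 (h j)).1
      (abs_le.1 (h j)).2
  calc (∑ i, (x ⬝ᵥ W i) * e i) ^ 2 ≤ (∑ j, x j ^ 2) * ∑ j, (∑ i, W i j * e i) ^ 2 := by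
        rw [hswap]
        exact Finset.sum_mul_sq_le_sq_mul_sq _ _ _
    _ ≤ (∑ j, x j ^ 2) * (d * r ^ 2) := by gcongr
    _ = d * r ^ 2 * (x ⬝ᵥ x) := by simp only [dotProduct, sq, mul_comm]

/-- A random vector all of whose linear functionals are centred and sub-Gaussian at the scale of
their standard deviation: `⟨v, V⟩` has variance proxy `c * Var ⟨v, V⟩`. -/
def IsSubGaussianVector (P : Measure Ω) (c : ℝ≥0) (V : Ω → Fin d → ℝ) : Prop :=
  ∀ v, HasSubgaussianMGF (fun ω => v ⬝ᵥ V ω) (c * (sqNormOf (covMat P V) v).toNNReal) P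

namespace IsSubGaussianVector

theorem memLp (hV : IsSubGaussianVector P c V) (j : Fin d) : MemLp (fun ω => V ω j) 2 P := by
  simpa only [single_one_dotProduct, ENNReal.coe_ofNat] using (hV (Pi.single j 1)).memLp 2

theorem mono (hV : IsSubGaussianVector P c V) {c' : ℝ≥0} (hc : c ≤ c') :
    IsSubGaussianVector P c' V :=
  fun v => hasSubgaussianMGF_mono (hV v) (by gcongr)

variable [IsProbabilityMeasure P]

theorem mean_zero (hV : IsSubGaussianVector P c V) (j : Fin d) : ∫ ω, V ω j ∂P = 0 := by
  simpa only [single_one_dotProduct] using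
    integral_eq_zero_of_hasSubgaussianMGF (hV (Pi.single j 1))

theorem posSemidef (hV : IsSubGaussianVector P c V) : (covMat P V).PosSemidef :=
  covMat_posSemidef hV.memLp

theorem hasSubgaussianMGF_dotProduct_whiten (hV : IsSubGaussianVector P c V) {u : Fin d → ℝ}
    (hu : u ⬝ᵥ u = 1) : HasSubgaussianMGF (fun ω => u ⬝ᵥ whiten (covMat P V) (V ω)) c P := by
  simp only [dotProduct_whiten]
  refine hasSubgaussianMGF_mono (hV _) (mul_le_of_le_one_right' ?_)
  rw [Real.toNNReal_le_one, ← hu]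
  exact sqNormOf_whiten_le hV.posSemidef u

theorem ae_psdSqrt_mulVec_whiten (hV : IsSubGaussianVector P c V) :
    ∀ᵐ ω ∂P, psdSqrt (covMat P V) *ᵥ whiten (covMat P V) (V ω) = V ω := by
  have hnull : ∀ j, ∀ᵐ ω ∂P, (Pi.single j 1 - whiten (covMat P V)
      (psdSqrt (covMat P V) *ᵥ Pi.single j 1)) ⬝ᵥ V ω = 0 := fun j => by
    have h := hV
      (Pi.single j 1 - whiten (covMat P V) (psdSqrt (covMat P V) *ᵥ Pi.single j 1))
    rw [sqNormOf_sub_whiten_psdSqrt_mulVec hV.posSemidef, Real.toNNReal_zero, mul_zero] at h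
    exact h.ae_eq_zero_of_hasSubgaussianMGF_zero
  filter_upwards [ae_all_iff.2 hnull] with ω hω
  ext j
  have h := hω j
  rw [sub_dotProduct, ← dotProduct_whiten, single_dotProduct, one_mul, sub_eq_zero,
    dotProduct_comm, dotProduct_mulVec_eq_transpose_mulVec_dotProduct, (isSymm_psdSqrt _).eq,
    dotProduct_single_one] at h
  exact h.symm

variable {ι Ω' : Type*} [MeasurableSpace Ω'] {P' : Measure Ω'}

theorem ae_forall_dotProduct_eq_whiten [Countable ι] (hV : IsSubGaussianVector P c V)
    {Vs : ι → Ω' → Fin d → ℝ} (hVs : IsIIDCopies P V P' Vs) :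
    ∀ᵐ ω ∂P', ∀ i b, b ⬝ᵥ Vs i ω =
      psdSqrt (covMat P V) *ᵥ b ⬝ᵥ whiten (covMat P V) (Vs i ω) := by
  have hmeas : MeasurableSet {x | psdSqrt (covMat P V) *ᵥ whiten (covMat P V) x = x} :=
    measurableSet_eq_fun
      ((Continuous.matrix_mulVec continuous_const continuous_id).measurable.comp
        (measurable_whiten _)) measurable_id
  filter_upwards [hVs.ae_forall_mem hmeas hV.ae_psdSqrt_mulVec_whiten] with ω hω i b
  conv_lhs => rw [← hω i, dotProduct_mulVec_eq_transpose_mulVec_dotProduct, (isSymm_psdSqrt _).eq]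

variable [Fintype ι] [IsProbabilityMeasure P']

theorem measureReal_exists_abs_sum_sq_sub_gt_le_exp (hV : IsSubGaussianVector P c V)
    {Vs : ι → Ω' → Fin d → ℝ} (hVs : IsIIDCopies P V P' Vs) {τ : ℝ} (hτ : 0 ≤ τ)
    (hτ' : τ ≤ 128) :
    P'.real {ω | ∃ b, 32 * (Fintype.card ι * (c * τ)) * sqNormOf (covMat P V) b <
        |∑ i, ((b ⬝ᵥ Vs i ω) ^ 2 - sqNormOf (covMat P V) b)|} ≤
      5 ^ d * (2 * Real.exp (-(Fintype.card ι * (3 * τ ^ 2 / 4096)))) := by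
  have hae := hV.ae_forall_dotProduct_eq_whiten hVs
  set Q := covMat P V
  have hQ : Q.PosSemidef := hV.posSemidef
  have hsymm : (pinv (psdSqrt Q) * Q * pinv (psdSqrt Q)).IsSymm := by
    simp only [Matrix.IsSymm, Matrix.transpose_mul, (isSymm_pinv (isSymm_psdSqrt Q)).eq,
      (isHermitian_iff_isSymm.1 hQ.1).eq, Matrix.mul_assoc]
  refine le_trans ?_ (FactorRegression.measureReal_exists_abs_sum_sq_sub_gt_le_exp
    (hVs.comp (measurable_whiten Q)) (fun u hu => hV.hasSubgaussianMGF_dotProduct_whiten hu) hsymm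
    (fun u => ?_) hτ hτ')
  · refine ENNReal.toReal_mono (measure_ne_top _ _) (measure_mono_ae ?_)
    filter_upwards [hae] with ω hω
    rintro ⟨b, hb⟩
    refine ⟨psdSqrt Q *ᵥ b, ?_⟩
    simpa only [← hω, ← sqNormOf_eq_psdSqrt_mulVec_dotProduct hQ, sqNormOf_mul_mul_pinv_psdSqrt,
      sqNormOf_whiten_psdSqrt_mulVec hQ] using hb
  · simp only [dotProduct_whiten, sqNormOf_mul_mul_pinv_psdSqrt]
    exact integral_dotProduct_sq hV.memLp hV.mean_zero _

theorem measureReal_exists_sum_mul_sq_gt_le_exp (hV : IsSubGaussianVector P c V) {ε : Ω → ℝ}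
    {a : ℝ≥0} (hε : HasSubgaussianMGF ε a P) (h0 : ∀ b, ∫ ω, (b ⬝ᵥ V ω) * ε ω ∂P = 0)
    {Vs : ι → Ω' → Fin d → ℝ} {εs : ι → Ω' → ℝ}
    (hs : IsIIDCopies P (fun ω => (V ω, ε ω)) P' (fun i ω => (Vs i ω, εs i ω))) {τ : ℝ}
    (hτ : 0 ≤ τ) (hτ' : τ ≤ 128) :
    P'.real {ω | ∃ b, d * (Fintype.card ι ^ 2 * (c * a * τ ^ 2)) * sqNormOf (covMat P V) b <
        (∑ i, (b ⬝ᵥ Vs i ω) * εs i ω) ^ 2} ≤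
      d * (2 * Real.exp (-(Fintype.card ι * (3 * τ ^ 2 / 4096)))) := by
  set W : (Fin d → ℝ) → Fin d → ℝ := fun x j => Pi.single j 1 ⬝ᵥ whiten (covMat P V) x with hW
  have hcov : ∀ j, ∫ ω, W (V ω) j * ε ω ∂P = 0 := fun j => by
    simp only [hW, dotProduct_whiten, h0]
  have hcoord : ∀ j ∈ Finset.univ, P'.real {ω | Fintype.card ι * (√(c * a) * τ) <
        |∑ i, (W (Vs i ω) j * εs i ω - ∫ ω, W (V ω) j * ε ω ∂P)|} ≤
      2 * Real.exp (-(Fintype.card ι * (3 * τ ^ 2 / 4096))) := fun j _ =>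
    measureReal_abs_sum_sub_integral_gt_le_exp
      (hV.hasSubgaussianMGF_dotProduct_whiten (by simp)) hε
      (hs.comp (g := fun z => W z.1 j * z.2) (by
        have := measurable_whiten (covMat P V)
        simp only [hW]
        fun_prop)) hτ hτ'
  have hcover : {ω | ∃ b, d * (Fintype.card ι ^ 2 * (c * a * τ ^ 2)) * sqNormOf (covMat P V) b <
        (∑ i, (b ⬝ᵥ Vs i ω) * εs i ω) ^ 2} ≤ᵐ[P']
      ⋃ j ∈ Finset.univ, {ω | Fintype.card ι * (√(c * a) * τ) <
        |∑ i, (W (Vs i ω) j * εs i ω - ∫ ω, W (V ω) j * ε ω ∂P)|} := by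
    filter_upwards [hV.ae_forall_dotProduct_eq_whiten (hs.comp measurable_fst)] with ω hω
    rintro ⟨b, hb⟩
    by_contra hnot
    have hcoordinates : ∀ j, |∑ i, W (Vs i ω) j * εs i ω| ≤
        Fintype.card ι * (√(c * a) * τ) := fun j => by
      by_contra! hj
      refine hnot (Set.mem_biUnion (Finset.mem_coe.2 (Finset.mem_univ j)) ?_)
      simpa only [Set.mem_ofPred_eq, hcov, sub_zero] using hj
    simp only [hW, single_one_dotProduct] at hcoordinates
    refine hb.not_ge ?_
    simp only [hω]
    refine (sum_dotProduct_mul_sq_le hcoordinates _).trans_eq ?_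
    rw [← sqNormOf_eq_psdSqrt_mulVec_dotProduct hV.posSemidef, mul_pow, mul_pow,
      Real.sq_sqrt (by positivity)]
  calc _ ≤ ∑ j, _ := (ENNReal.toReal_mono (measure_ne_top _ _) (measure_mono_ae hcover)).trans
        (measureReal_biUnion_finset_le _ _)
    _ ≤ (Finset.univ : Finset (Fin d)).card • _ := Finset.sum_le_card_nsmul _ _ _ hcoord
    _ = _ := by rw [nsmul_eq_mul, Finset.card_univ, Fintype.card_fin]

theorem of_psdSqrt_mulVec {M : ℝ} (hM : 0 < M) (hV : ∀ j, MemLp (fun ω => V ω j) 2 P)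
    {Vt : Ω → Fin d → ℝ} (hind : iIndepFun (fun j ω => Vt ω j) P)
    (hsub : ∀ j, IsCenteredSubGaussian P M (fun ω => Vt ω j))
    (heq : ∀ᵐ ω ∂P, V ω = psdSqrt (covMat P V) *ᵥ Vt ω) :
    IsSubGaussianVector P (8 * M ^ 2).toNNReal V := fun v => by
  set u := psdSqrt (covMat P V) *ᵥ v with hu
  have hscaled : ∀ j ∈ Finset.univ, HasSubgaussianMGF (fun ω => u j * Vt ω j)
      ((8 * M ^ 2).toNNReal * (u j ^ 2).toNNReal) P := fun j _ =>
    hasSubgaussianMGF_const_mul ((hsub j).hasSubgaussianMGF hM)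
      (by rw [NNReal.coe_mul, Real.coe_toNNReal _ (sq_nonneg _), mul_comm])
  have hsum := HasSubgaussianMGF.sum_of_iIndepFun (X := fun j ω => u j * Vt ω j)
    (hind.comp (fun j x => u j * x) fun j => by fun_prop) hscaled
  have hsum_eq : (fun ω => v ⬝ᵥ V ω) =ᵐ[P] fun ω => ∑ j, u j * Vt ω j := by
    filter_upwards [heq] with ω hω
    rw [hω, dotProduct_mulVec_eq_transpose_mulVec_dotProduct, (isSymm_psdSqrt _).eq]
    rfl
  refine hasSubgaussianMGF_mono (hsum.congr hsum_eq.symm) (le_of_eq ?_)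
  ext
  rw [NNReal.coe_mul, Real.coe_toNNReal _ (sqNormOf_nonneg (covMat_posSemidef hV) v),
    sqNormOf_eq_psdSqrt_mulVec_dotProduct (covMat_posSemidef hV), ← hu, dotProduct, Finset.mul_sum,
    NNReal.coe_sum]
  exact Finset.sum_congr rfl fun j _ => by
    rw [NNReal.coe_mul, Real.coe_toNNReal _ (sq_nonneg _), sq (u j)]

end IsSubGaussianVector

end SubGaussianVector

section LeastSquares

open scoped Matrix

variable {m k : ℕ}

theorem transpose_mulVec_mulVec_pinv_mulVec (B : Matrix (Fin m) (Fin k) ℝ) (y : Fin m → ℝ) :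
    Bᵀ *ᵥ B *ᵥ pinv B *ᵥ y = Bᵀ *ᵥ y := by
  obtain ⟨hmul, -, hsymm, -⟩ := pinv_spec B
  have hBT : Bᵀ * (B * pinv B) = Bᵀ := by rw [← hsymm.eq, ← Matrix.transpose_mul, hmul]
  rw [Matrix.mulVec_mulVec, Matrix.mulVec_mulVec, Matrix.mul_assoc, hBT]

/-- The signal part `B v` of the response is fitted exactly, so testing the normal equations against
`pinv B y - v` leaves only the contributions of `e` and `h`. -/
theorem apply_pinv_mulVec_sub_le {B : Matrix (Fin m) (Fin k) ℝ} {q : (Fin k → ℝ) → ℝ} {l G : ℝ}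
    (hl : 0 < l) (hG : 0 ≤ G) (hq : ∀ b, l * q b ≤ B *ᵥ b ⬝ᵥ B *ᵥ b) {e : Fin m → ℝ}
    (he : ∀ b, (B *ᵥ b ⬝ᵥ e) ^ 2 ≤ G * q b) (v : Fin k → ℝ) (h : Fin m → ℝ) :
    q (pinv B *ᵥ (B *ᵥ v + e - h) - v) ≤ 2 * G / l ^ 2 + 2 * (h ⬝ᵥ h) / l := by
  set d := pinv B *ᵥ (B *ᵥ v + e - h) - v with hd
  set a := B *ᵥ d ⬝ᵥ B *ᵥ d
  have ha : 0 ≤ a := by simpa using dotProduct_self_star_nonneg (B *ᵥ d)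
  have hnormal : a = B *ᵥ d ⬝ᵥ e - B *ᵥ d ⬝ᵥ h := by
    have : Bᵀ *ᵥ B *ᵥ d = Bᵀ *ᵥ (e - h) := by
      rw [hd, Matrix.mulVec_sub, Matrix.mulVec_sub, transpose_mulVec_mulVec_pinv_mulVec,
        ← Matrix.mulVec_sub, add_sub_assoc, add_sub_cancel_left]
    rw [← dotProduct_sub, dotProduct_comm (B *ᵥ d) (e - h),
      dotProduct_mulVec_eq_transpose_mulVec_dotProduct, ← this,
      ← dotProduct_mulVec_eq_transpose_mulVec_dotProduct]
  have hnoise : B *ᵥ d ⬝ᵥ e ≤ a / 4 + G / l := by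
    refine (le_abs_self _).trans (abs_le_of_sq_le_sq ?_ (by positivity))
    calc (B *ᵥ d ⬝ᵥ e) ^ 2 ≤ G * q d := he d
      _ ≤ G * (a / l) := by
          gcongr
          exact (le_div_iff₀' hl).2 (hq d)
      _ ≤ (a / 4 + G / l) ^ 2 := by
          rw [show G * (a / l) = a * (G / l) by ring]
          linarith [sq_nonneg (a / 4 - G / l)]
  have hbias : -(B *ᵥ d ⬝ᵥ h) ≤ a / 4 + h ⬝ᵥ h := by
    have hsq : 0 ≤ ((1 / 2 : ℝ) • B *ᵥ d + h) ⬝ᵥ ((1 / 2 : ℝ) • B *ᵥ d + h) := by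
      simpa using dotProduct_self_star_nonneg ((1 / 2 : ℝ) • B *ᵥ d + h)
    simp only [add_dotProduct, dotProduct_add, smul_dotProduct, dotProduct_smul, smul_eq_mul,
      dotProduct_comm h] at hsq
    linarith
  calc q d ≤ a / l := (le_div_iff₀' hl).2 (hq d)
    _ ≤ (2 * (G / l) + 2 * (h ⬝ᵥ h)) / l := by gcongr; linarith
    _ = 2 * G / l ^ 2 + 2 * (h ⬝ᵥ h) / l := by field_simp

end LeastSquares

section Risk

open scoped Matrix

variable {Ω : Type*} [MeasurableSpace Ω] {P : Measure Ω}

theorem integral_sub_sq_sub_variance {F ε : Ω → ℝ} (hF : MemLp F 2 P) (hε : MemLp ε 2 P)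
    (hε0 : ∫ ω, ε ω ∂P = 0) (hFε : ∫ ω, F ω * ε ω ∂P = 0) :
    ∫ ω, (F ω - ε ω) ^ 2 ∂P - Var[ε; P] = ∫ ω, F ω ^ 2 ∂P := by
  have hcross : Integrable (fun ω => 2 * (F ω * ε ω)) P := (hF.integrable_mul hε).const_mul 2
  have hdiff : Integrable (fun ω => F ω ^ 2 - 2 * (F ω * ε ω)) P := hF.integrable_sq.sub hcross
  have hexpand : ∀ ω, (F ω - ε ω) ^ 2 = F ω ^ 2 - 2 * (F ω * ε ω) + ε ω ^ 2 := fun ω => by ring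
  simp only [hexpand]
  rw [variance_of_integral_eq_zero hε.aemeasurable hε0,
    integral_add hdiff hε.integrable_sq,
    integral_sub hF.integrable_sq hcross, integral_const_mul, hFε]
  ring

variable [IsProbabilityMeasure P] {p : ℕ}

theorem integral_dotProduct_add_dotProduct_sq_le {X E : Ω → Fin p → ℝ}
    (hX : ∀ j, MemLp (fun ω => X ω j) 2 P) (hX0 : ∀ j, ∫ ω, X ω j ∂P = 0)
    (hE : ∀ j, MemLp (fun ω => E ω j) 2 P) (hE0 : ∀ j, ∫ ω, E ω j ∂P = 0) (a b : Fin p → ℝ) :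
    ∫ ω, (a ⬝ᵥ X ω + b ⬝ᵥ E ω) ^ 2 ∂P ≤
      2 * sqNormOf (covMat P X) a + 2 * sqNormOf (covMat P E) b := by
  have haX := memLp_dotProduct hX a
  have hbE := memLp_dotProduct hE b
  calc ∫ ω, (a ⬝ᵥ X ω + b ⬝ᵥ E ω) ^ 2 ∂P
      ≤ ∫ ω, (2 * (a ⬝ᵥ X ω) ^ 2 + 2 * (b ⬝ᵥ E ω) ^ 2) ∂P :=
        integral_mono (haX.add hbE).integrable_sq
          ((haX.integrable_sq.const_mul 2).add (hbE.integrable_sq.const_mul 2)) fun ω => by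
            linarith [add_sq_le (a := a ⬝ᵥ X ω) (b := b ⬝ᵥ E ω)]
    _ = _ := by
        rw [integral_add (haX.integrable_sq.const_mul 2) (hbE.integrable_sq.const_mul 2),
          integral_const_mul, integral_const_mul, integral_dotProduct_sq hX hX0,
          integral_dotProduct_sq hE hE0]

end Risk

section SignalToNoise

open scoped Matrix

variable {p K : ℕ} {A : Matrix (Fin p) (Fin K) ℝ} {SZ : Matrix (Fin K) (Fin K) ℝ}
  {SE : Matrix (Fin p) (Fin p) ℝ}

theorem ofReal_sqNormOf_le_ofReal_div_snr (hpos : 0 < ordEig (A * SZ * Aᵀ) K) {v : Fin p → ℝ}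
    {r : ℝ} (hv : ordEig (A * SZ * Aᵀ) K * (v ⬝ᵥ v) ≤ r) :
    ENNReal.ofReal (sqNormOf SE v) ≤ ENNReal.ofReal r / snr A SZ SE := by
  rcases eq_or_ne SE 0 with rfl | hSE
  · simp [sqNormOf]
  have hop := opNorm_pos hSE
  rw [snr, ← ENNReal.ofReal_div_of_pos hop, ← ENNReal.ofReal_div_of_pos (by positivity)]
  refine ENNReal.ofReal_le_ofReal ((sqNormOf_le_opNorm_mul SE v).trans ?_)
  rw [le_div_iff₀ (by positivity)]
  calc opNorm SE * (v ⬝ᵥ v) * (ordEig (A * SZ * Aᵀ) K / opNorm SE)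
      = ordEig (A * SZ * Aᵀ) K * (v ⬝ᵥ v) := by field_simp
    _ ≤ r := hv

theorem div_snr_le_condNumber_mul (hpos : 0 < ordEig (A * SZ * Aᵀ) K) (hSE : SE.PosSemidef)
    (r : ℝ) :
    ENNReal.ofReal r / snr A SZ SE ≤ condNumber SE * (ENNReal.ofReal r / snr A SZ SE) := by
  rcases eq_or_ne SE 0 with rfl | h0
  · have hsnr : snr A SZ (0 : Matrix (Fin p) (Fin p) ℝ) = ∞ := by
      simp [snr, opNorm, ENNReal.div_zero, hpos]
    simp [hsnr]
  · exact le_mul_of_one_le_left zero_le (one_le_condNumber hSE h0)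

end SignalToNoise

section FailureEvents

open Real
open scoped NNReal

variable {Ω Ω' : Type*} [MeasurableSpace Ω] [MeasurableSpace Ω'] {P : Measure Ω}
  [IsProbabilityMeasure P] {P' : Measure Ω'} [IsProbabilityMeasure P'] {d n : ℕ}
  {V : Ω → Fin d → ℝ} {Vs : Fin n → Ω' → Fin d → ℝ} {c : ℝ≥0}

namespace IsSubGaussianVector

theorem measureReal_exists_sum_sq_lt_le_exp (hV : IsSubGaussianVector P c V) (hc : 1 ≤ c)
    (hVs : IsIIDCopies P V P' Vs) :
    P'.real {ω | ∃ b, ∑ i, (b ⬝ᵥ Vs i ω) ^ 2 < n / 2 * sqNormOf (covMat P V) b} ≤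
      5 ^ d * (2 * exp (-(n * (3 / (4096 * c) ^ 2)))) := by
  have : (1 : ℝ) ≤ c := hc
  have htail := hV.measureReal_exists_abs_sum_sq_sub_gt_le_exp hVs (τ := 1 / (64 * c))
    (by positivity) ((div_le_one₀ (by positivity)).2 (by linarith) |>.trans (by norm_num))
  rw [Fintype.card_fin, show 3 * (1 / (64 * (c : ℝ))) ^ 2 / 4096 = 3 / (4096 * c) ^ 2 by
    field_simp; ring, show 32 * (n * (c * (1 / (64 * (c : ℝ))))) = n / 2 by
    field_simp; ring] at htail
  refine (measureReal_mono fun ω => ?_).trans htail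
  rintro ⟨b, hb⟩
  refine ⟨b, lt_of_lt_of_le ?_ (neg_le_abs _)⟩
  rw [Finset.sum_sub_distrib, Finset.sum_const, Finset.card_univ, Fintype.card_fin, nsmul_eq_mul]
  linarith

theorem measureReal_sum_sq_gt_le_exp (hV : IsSubGaussianVector P c V) (hc : 1 ≤ c)
    (hVs : IsIIDCopies P V P' Vs) (v : Fin d → ℝ) :
    P'.real {ω | 2 * n * sqNormOf (covMat P V) v < ∑ i, (v ⬝ᵥ Vs i ω) ^ 2} ≤
      2 * exp (-(n * (3 / (4096 * c) ^ 2))) := by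
  have : (1 : ℝ) ≤ c := hc
  have htail := measureReal_abs_sum_sub_integral_gt_le_exp (P' := P')
    (Ys := fun i ω => (v ⬝ᵥ Vs i ω) * (v ⬝ᵥ Vs i ω)) (hV v) (hV v)
    (hVs.comp (g := fun x => (v ⬝ᵥ x) * (v ⬝ᵥ x)) (by fun_prop)) (τ := 1 / (64 * c))
    (by positivity) ((div_le_one₀ (by positivity)).2 (by linarith) |>.trans (by norm_num))
  have hnn := sqNormOf_nonneg hV.posSemidef v
  simp only [← sq, integral_dotProduct_sq hV.memLp hV.mean_zero, Fintype.card_fin,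
    NNReal.coe_mul, coe_toNNReal _ hnn,
    Finset.sum_sub_distrib, Finset.sum_const, Finset.card_univ, nsmul_eq_mul] at htail
  rw [sqrt_sq (by positivity),
    show 3 * (1 / (64 * (c : ℝ))) ^ 2 / 4096 = 3 / (4096 * c) ^ 2 by field_simp; ring,
    show ∀ q, n * (c * q * (1 / (64 * (c : ℝ)))) = n * q / 64 by intro q; field_simp] at htail
  refine (measureReal_mono fun ω hω => ?_).trans htail
  refine lt_of_lt_of_le (b := _ - n * sqNormOf (covMat P V) v) ?_ (le_abs_self _)
  rw [Set.mem_ofPred_eq] at hω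
  linarith [mul_nonneg n.cast_nonneg hnn]

/-- The deviation is chosen so that the union bound over coordinates has failure probability of
order `d / n ^ 2`. -/
theorem measureReal_exists_sum_mul_sq_gt_le_div (hV : IsSubGaussianVector P c V) {ε : Ω → ℝ}
    {a : ℝ≥0} (hε : HasSubgaussianMGF ε a P) (h0 : ∀ b, ∫ ω, (b ⬝ᵥ V ω) * ε ω ∂P = 0)
    {εs : Fin n → Ω' → ℝ}
    (hs : IsIIDCopies P (fun ω => (V ω, ε ω)) P' (fun i ω => (Vs i ω, εs i ω))) (hn : 0 < n) :
    P'.real {ω | ∃ b, 8192 / 3 * (d * n * (c * a) * log n) * sqNormOf (covMat P V) b <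
        (∑ i, (b ⬝ᵥ Vs i ω) * εs i ω) ^ 2} ≤ d * (2 / (n : ℝ) ^ 2) := by
  have hn' : (0 : ℝ) < n := by exact_mod_cast hn
  set τ := √(8192 / 3 * log n / n) with hτ
  have hτ2 : τ ^ 2 = 8192 / 3 * log n / n := by
    have := log_natCast_nonneg n
    exact sq_sqrt (by positivity)
  have hτ128 : τ ≤ 128 := by
    refine sqrt_le_iff.2 ⟨by norm_num, (div_le_iff₀ hn').2 ?_⟩
    linarith [log_le_self hn'.le]
  have htail := hV.measureReal_exists_sum_mul_sq_gt_le_exp hε h0 hs (sqrt_nonneg _) hτ128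
  rw [← hτ, hτ2, Fintype.card_fin,
    show n * (3 * (8192 / 3 * log n / n) / 4096) = ((2 : ℕ) : ℝ) * log n by
      push_cast; field_simp; ring,
    show (n : ℝ) ^ 2 * (c * a * (8192 / 3 * log n / n)) = 8192 / 3 * (n * (c * a) * log n) by
      field_simp,
    exp_neg, exp_nat_mul, exp_log hn', ← div_eq_mul_inv] at htail
  refine le_trans (le_of_eq ?_) htail
  congr! 6
  ring

end IsSubGaussianVector

end FailureEvents

section FactorModel

open scoped Matrix NNReal

theorem response_eq {p K : ℕ} {A : Matrix (Fin p) (Fin K) ℝ} {β : Fin K → ℝ}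
    {v : Fin p → ℝ} (hv : Aᵀ *ᵥ v = β) {Ω : Type*}
    (Z : Ω → Fin K → ℝ) (E : Ω → Fin p → ℝ) (ε : Ω → ℝ) (ω : Ω) :
    response β Z ε ω = v ⬝ᵥ features A Z E ω + ε ω - v ⬝ᵥ E ω := by
  rw [response, features, dotProduct_add, dotProduct_mulVec_eq_transpose_mulVec_dotProduct, hv,
    dotProduct_comm]
  ring

variable {Ω : Type*} [MeasurableSpace Ω] {P : Measure Ω} {c : ℝ≥0} {n p K : ℕ}
  {A : Matrix (Fin p) (Fin K) ℝ} {β : Fin K → ℝ} {Z : Ω → Fin K → ℝ} {E : Ω → Fin p → ℝ}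
  {ε : Ω → ℝ}

/-- A factor regression model in which the features, the idiosyncratic noise `E` and the error `ε`
are sub-Gaussian at the scale of their standard deviations, with common constant `c`. Of the
independence assumptions only the uncorrelatedness of `ε` with the features and with `E` is kept. -/
structure IsSubGaussianFactorModel (P : Measure Ω) (c : ℝ≥0) (A : Matrix (Fin p) (Fin K) ℝ)
    (Z : Ω → Fin K → ℝ) (E : Ω → Fin p → ℝ) (ε : Ω → ℝ) : Prop where
  memLp_factor : ∀ a, MemLp (fun ω => Z ω a) 2 P
  subGaussian_features : IsSubGaussianVector P c (features A Z E)
  subGaussian_noise : IsSubGaussianVector P c E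
  subGaussian_error : HasSubgaussianMGF ε (c * Var[ε; P].toNNReal) P
  integral_features_mul_error : ∀ b, ∫ ω, (b ⬝ᵥ features A Z E ω) * ε ω ∂P = 0
  integral_noise_mul_error : ∀ b, ∫ ω, (b ⬝ᵥ E ω) * ε ω ∂P = 0

namespace IsSubGaussianFactorModel

theorem mono (h : IsSubGaussianFactorModel P c A Z E ε) {c' : ℝ≥0} (hc : c ≤ c') :
    IsSubGaussianFactorModel P c' A Z E ε :=
  { h with
    subGaussian_features := h.subGaussian_features.mono hc
    subGaussian_noise := h.subGaussian_noise.mono hc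
    subGaussian_error := hasSubgaussianMGF_mono h.subGaussian_error (by gcongr) }

variable [IsProbabilityMeasure P]

theorem risk_sub_variance_le (h : IsSubGaussianFactorModel P c A Z E ε) {v : Fin p → ℝ}
    (hv : Aᵀ *ᵥ v = β) (α : Fin p → ℝ) :
    risk P (features A Z E) (response β Z ε) α - Var[ε; P] ≤
      2 * sqNormOf (covMat P (features A Z E)) (α - v) +
        2 * sqNormOf (covMat P E) v := by
  set X := features A Z E
  have hε : MemLp ε 2 P := h.subGaussian_error.memLp 2
  have hX := memLp_dotProduct h.subGaussian_features.memLp (α - v)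
  have hE := memLp_dotProduct h.subGaussian_noise.memLp v
  have huncorrelated : ∫ ω, ((α - v) ⬝ᵥ X ω + v ⬝ᵥ E ω) * ε ω ∂P = 0 := by
    have hXε : Integrable (fun ω => ((α - v) ⬝ᵥ X ω) * ε ω) P := hX.integrable_mul hε
    have hEε : Integrable (fun ω => (v ⬝ᵥ E ω) * ε ω) P := hE.integrable_mul hε
    simp only [add_mul]
    rw [integral_add hXε hEε,
      h.integral_features_mul_error, h.integral_noise_mul_error, add_zero]
  have hresidual (ω : Ω) :
      X ω ⬝ᵥ α - response β Z ε ω = (α - v) ⬝ᵥ X ω + v ⬝ᵥ E ω - ε ω := by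
    rw [response_eq hv Z E, sub_dotProduct, dotProduct_comm α]
    ring
  simp only [risk, hresidual]
  have hF : MemLp (fun ω => (α - v) ⬝ᵥ X ω + v ⬝ᵥ E ω) 2 P := hX.add hE
  rw [integral_sub_sq_sub_variance hF hε (integral_eq_zero_of_hasSubgaussianMGF h.subGaussian_error)
    huncorrelated]
  exact integral_dotProduct_add_dotProduct_sq_le h.subGaussian_features.memLp
    h.subGaussian_features.mean_zero
    h.subGaussian_noise.memLp h.subGaussian_noise.mean_zero _ _

theorem risk_gls_sub_variance_le (h : IsSubGaussianFactorModel P c A Z E ε) {v : Fin p → ℝ}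
    (hv : Aᵀ *ᵥ v = β) {Ω' : Type*} {Zs : Fin n → Ω' → Fin K → ℝ} {Es : Fin n → Ω' → Fin p → ℝ}
    {εs : Fin n → Ω' → ℝ} {ω : Ω'} {l G H : ℝ} (hl : 0 < l) (hG : 0 ≤ G)
    (hdesign : ∀ b, l * sqNormOf (covMat P (features A Z E)) b ≤
      ∑ i, (b ⬝ᵥ features A (Zs i) (Es i) ω) ^ 2)
    (herror : ∀ b, (∑ i, (b ⬝ᵥ features A (Zs i) (Es i) ω) * εs i ω) ^ 2 ≤
      G * sqNormOf (covMat P (features A Z E)) b)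
    (hnoise : ∑ i, (v ⬝ᵥ Es i ω) ^ 2 ≤ H) :
    risk P (features A Z E) (response β Z ε)
        (gls (fun i => features A (Zs i) (Es i))
          (fun i => response β (Zs i) (εs i)) ω) - Var[ε; P] ≤
      2 * (2 * G / l ^ 2 + 2 * H / l) + 2 * sqNormOf (covMat P E) v := by
  set B := Matrix.of fun i j => features A (Zs i) (Es i) ω j
  have hB : ∀ b i, (B *ᵥ b) i = b ⬝ᵥ features A (Zs i) (Es i) ω := fun b i =>
    dotProduct_comm _ _
  have hresponse : (fun i => response β (Zs i) (εs i) ω) =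
      B *ᵥ v + (fun i => εs i ω) - fun i => v ⬝ᵥ Es i ω := by
    ext i
    simp only [Pi.sub_apply, Pi.add_apply, hB, response_eq hv (Zs i) (Es i)]
  have hfit := apply_pinv_mulVec_sub_le (B := B) hl hG
    (q := sqNormOf (covMat P (features A Z E)))
    (fun b => by simpa only [dotProduct, hB, ← sq] using hdesign b)
    (e := fun i => εs i ω) (fun b => by simpa only [dotProduct, hB] using herror b) v
    (fun i => v ⬝ᵥ Es i ω)
  rw [← hresponse, dotProduct] at hfit
  simp only [← sq] at hfit
  refine (h.risk_sub_variance_le hv _).trans ?_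
  gcongr
  refine hfit.trans ?_
  gcongr

end IsSubGaussianFactorModel

end FactorModel

section RiskBound

open Real
open scoped Matrix NNReal

theorem five_pow_mul_exp_neg_le {d n : ℕ} {r : ℝ} (hr : 0 < r) (h : 4 / r * d < n) :
    5 ^ d * exp (-(n * r)) ≤ 2 / (r * n) := by
  have hn : (0 : ℝ) < n := lt_of_le_of_lt (by positivity) h
  have hd : 4 * d < n * r := by rwa [div_mul_eq_mul_div, div_lt_iff₀ hr] at h
  have hexp_two : (5 : ℝ) ≤ exp 2 := by
    rw [← one_add_one_eq_two, exp_add]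
    nlinarith [exp_one_gt_d9]
  calc 5 ^ d * exp (-(n * r)) ≤ exp 2 ^ d * exp (-(n * r)) := by gcongr
    _ = exp (d * 2 - n * r) := by rw [← exp_nat_mul, ← exp_add, sub_eq_add_neg]
    _ ≤ exp (-(r * n / 2)) := exp_le_exp.2 (by linarith)
    _ ≤ (r * n / 2)⁻¹ := by
      rw [exp_neg]
      gcongr
      linarith [add_one_le_exp (r * n / 2)]
    _ = 2 / (r * n) := inv_div _ _

theorem failure_probability_le {d n : ℕ} {r : ℝ} (hr : 0 < r) (hr4 : r ≤ 4)
    (h : 4 / r * d < n) :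
    5 ^ d * (2 * exp (-(n * r))) + d * (2 / (n : ℝ) ^ 2) + 2 * exp (-(n * r)) ≤
      (8 / r + 2) / n := by
  have hn : (0 : ℝ) < n := lt_of_le_of_lt (by positivity) h
  have hdn : (d : ℝ) ≤ n :=
    (le_mul_of_one_le_left d.cast_nonneg ((one_le_div hr).2 hr4)).trans h.le
  have hexp := five_pow_mul_exp_neg_le hr h
  have hcoord : d * (2 / (n : ℝ) ^ 2) ≤ 2 / n := by
    rw [mul_div_assoc', div_le_div_iff₀ (by positivity) hn]
    nlinarith
  have hone : exp (-(n * r)) ≤ 5 ^ d * exp (-(n * r)) :=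
    le_mul_of_one_le_left (exp_nonneg _) (one_le_pow₀ (by norm_num))
  calc 5 ^ d * (2 * exp (-(n * r))) + d * (2 / (n : ℝ) ^ 2) + 2 * exp (-(n * r))
      ≤ 2 * (2 / (r * n)) + 2 / n + 2 * (2 / (r * n)) := by linarith
    _ = (8 / r + 2) / n := by field_simp; ring

theorem one_sub_measureReal_add_le {α : Type*} [MeasurableSpace α] {μ : Measure α}
    [IsProbabilityMeasure μ] {s t u g : Set α}
    (h : ∀ x, x ∉ s → x ∉ t → x ∉ u → x ∈ g) :
    1 - (μ.real s + μ.real t + μ.real u) ≤ μ.real g := by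
  have hcover : Set.univ ⊆ s ∪ t ∪ u ∪ g := fun x _ => by
    by_contra hx
    simp only [Set.mem_union, not_or] at hx
    exact hx.2 (h x hx.1.1.1 hx.1.1.2 hx.1.2)
  have hunion := (measureReal_mono (μ := μ) hcover).trans
    ((measureReal_union_le _ _).trans (add_le_add_left ((measureReal_union_le _ _).trans
      (add_le_add_left (measureReal_union_le s t) _)) _))
  rw [probReal_univ] at hunion
  linarith

theorem IsIIDSample.isIIDCopies {Ω Ω' : Type*} [MeasurableSpace Ω] [MeasurableSpace Ω']
    {P : Measure Ω} {P' : Measure Ω'} {n p K : ℕ} {Z : Ω → Fin K → ℝ} {E : Ω → Fin p → ℝ}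
    {ε : Ω → ℝ} {Zs : Fin n → Ω' → Fin K → ℝ} {Es : Fin n → Ω' → Fin p → ℝ} {εs : Fin n → Ω' → ℝ}
    (h : IsIIDSample P Z E ε P' Zs Es εs) :
    IsIIDCopies P (fun ω => (Z ω, E ω, ε ω)) P' (fun i ω => (Zs i ω, Es i ω, εs i ω)) :=
  ⟨h.indep, h.identDistrib⟩

variable {Ω Ω' : Type*} [MeasurableSpace Ω] [MeasurableSpace Ω'] {P : Measure Ω}
  {P' : Measure Ω'} {c : ℝ≥0} {n p K : ℕ}
  {A : Matrix (Fin p) (Fin K) ℝ} {β : Fin K → ℝ} {Z : Ω → Fin K → ℝ} {E : Ω → Fin p → ℝ}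
  {ε : Ω → ℝ} {Zs : Fin n → Ω' → Fin K → ℝ} {Es : Fin n → Ω' → Fin p → ℝ} {εs : Fin n → Ω' → ℝ}

theorem IsFactorTriple.integral_mul_error (h : IsFactorTriple P Z E ε) (a : Fin K → ℝ)
    (b : Fin p → ℝ) : ∫ ω, (a ⬝ᵥ Z ω + b ⬝ᵥ E ω) * ε ω ∂P = 0 := by
  have hZ := memLp_dotProduct h.memLp_Z a
  have hE := memLp_dotProduct h.memLp_E b
  have hindep_Z : IndepFun (fun ω => a ⬝ᵥ Z ω) ε P :=
    h.indep_Z_noise.comp (φ := fun z => a ⬝ᵥ z) (ψ := Prod.snd) (by fun_prop) measurable_snd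
  have hindep_E : IndepFun (fun ω => b ⬝ᵥ E ω) ε P :=
    h.indep_E_ε.comp (φ := fun e => b ⬝ᵥ e) (ψ := id) (by fun_prop) measurable_id
  have hZε : Integrable (fun ω => (a ⬝ᵥ Z ω) * ε ω) P := hZ.integrable_mul h.memLp_ε
  have hEε : Integrable (fun ω => (b ⬝ᵥ E ω) * ε ω) P := hE.integrable_mul h.memLp_ε
  simp only [add_mul]
  rw [integral_add hZε hEε, hindep_Z.integral_fun_mul_eq_mul_integral hZ.1 h.memLp_ε.1,
    hindep_E.integral_fun_mul_eq_mul_integral hE.1 h.memLp_ε.1, h.mean_ε, mul_zero, mul_zero,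
    add_zero]

variable [IsProbabilityMeasure P]

theorem IsFactorTriple.isSubGaussianFactorModel {M : ℝ} (hM : 0 < M)
    (h : IsFactorTriple P Z E ε) {y : Ω → ℝ} (hdata : SubGaussianData P M (features A Z E) y)
    (hfactors : SubGaussianFactors P M Z E ε) :
    IsSubGaussianFactorModel P (8 * M ^ 2).toNNReal A Z E ε := by
  obtain ⟨⟨Xt, hXt_indep, hXt, hX⟩, -⟩ := hdata
  obtain ⟨⟨Et, hEt_indep, hEt, hE⟩, -, εt, hεt, hε⟩ := hfactors
  have hfeatures : ∀ j, MemLp (fun ω => features A Z E ω j) 2 P := fun j =>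
    (memLp_dotProduct h.memLp_Z (A j)).add (h.memLp_E j)
  have hscaled : HasSubgaussianMGF (fun ω => √Var[ε; P] * εt ω)
      ((8 * M ^ 2).toNNReal * Var[ε; P].toNNReal) P :=
    hasSubgaussianMGF_const_mul (hεt.hasSubgaussianMGF hM) (by
      rw [sq_sqrt (variance_nonneg _ _), NNReal.coe_mul, coe_toNNReal _ (variance_nonneg _ _),
        mul_comm])
  exact
    { memLp_factor := h.memLp_Z
      subGaussian_features := .of_psdSqrt_mulVec hM hfeatures hXt_indep
        (fun j => (hXt j).toIsCenteredSubGaussian) hX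
      subGaussian_noise := .of_psdSqrt_mulVec hM h.memLp_E hEt_indep
        (fun j => (hEt j).toIsCenteredSubGaussian) hE
      subGaussian_error := hscaled.congr (hε.mono fun _ => Eq.symm)
      integral_features_mul_error := fun b => by
        simpa only [features, dotProduct_add, dotProduct_mulVec_eq_transpose_mulVec_dotProduct]
          using h.integral_mul_error (Aᵀ *ᵥ b) b
      integral_noise_mul_error := fun b => by
        simpa only [zero_dotProduct, zero_add] using h.integral_mul_error 0 b }

variable [IsProbabilityMeasure P']

theorem IsSubGaussianFactorModel.one_sub_div_le_measureReal_risk_gls_le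
    (h : IsSubGaussianFactorModel P c A Z E ε) (hc : 1 ≤ c) {v : Fin p → ℝ} (hv : Aᵀ *ᵥ v = β)
    (hs : IsIIDSample P Z E ε P' Zs Es εs) (hn : 4 / (3 / (4096 * (c : ℝ)) ^ 2) * p < n) :
    1 - (8 / (3 / (4096 * (c : ℝ)) ^ 2) + 2) / n ≤ P'.real {ω |
      risk P (features A Z E) (response β Z ε)
          (gls (fun i => features A (Zs i) (Es i)) (fun i => response β (Zs i) (εs i)) ω) -
        Var[ε; P] ≤
      50000 * c ^ 2 * (sqNormOf (covMat P E) v + p / n * Var[ε; P] * log n)} := by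
  have : (1 : ℝ) ≤ c := hc
  have hn' : (0 : ℝ) < n := lt_of_le_of_lt (by positivity) hn
  have hfeatures : Measurable fun x : (Fin K → ℝ) × (Fin p → ℝ) × ℝ => A *ᵥ x.1 + x.2.1 := by
    fun_prop
  have hcopies := hs.isIIDCopies
  have hdesign := h.subGaussian_features.measureReal_exists_sum_sq_lt_le_exp hc
    (hcopies.comp hfeatures)
  have herror := h.subGaussian_features.measureReal_exists_sum_mul_sq_gt_le_div
    h.subGaussian_error h.integral_features_mul_error
    (hcopies.comp (hfeatures.prodMk (measurable_snd.comp measurable_snd))) (Nat.cast_pos.1 hn')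
  have hnoise := h.subGaussian_noise.measureReal_sum_sq_gt_le_exp hc
    (hcopies.comp (measurable_fst.comp measurable_snd)) v
  have hfailure := failure_probability_le (by positivity)
    ((div_le_one₀ (by positivity)).2 (by nlinarith) |>.trans (by norm_num)) hn
  refine (sub_le_sub_left ((add_le_add (add_le_add hdesign herror) hnoise).trans hfailure) 1).trans
    (one_sub_measureReal_add_le fun ω hdesign herror hnoise => ?_)
  simp only [Set.mem_ofPred_eq, not_exists, not_lt] at hdesign herror hnoise
  have hσ := variance_nonneg ε P
  have := log_natCast_nonneg n
  have hV := sqNormOf_nonneg h.subGaussian_noise.posSemidef v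
  refine (h.risk_gls_sub_variance_le hv (by positivity) (by positivity) hdesign herror hnoise).trans
    ?_
  rw [NNReal.coe_mul, coe_toNNReal _ hσ]
  calc _ = 16 * 8192 / 3 * (c ^ 2 * (p / n * Var[ε; P] * log n)) +
        18 * sqNormOf (covMat P E) v := by field_simp; ring
    _ ≤ 50000 * (c ^ 2 * (p / n * Var[ε; P] * log n)) +
        50000 * c ^ 2 * sqNormOf (covMat P E) v := by
      gcongr
      · norm_num
      · nlinarith
    _ = 50000 * c ^ 2 * (sqNormOf (covMat P E) v + p / n * Var[ε; P] * log n) := by ring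

end RiskBound

end FactorRegression

open FactorRegression in
open scoped NNReal in
theorem mainTheorem10_general (c : ℝ≥0) :
    ∃ C c' C' : ℝ, 0 < C ∧ 0 < c' ∧ 0 < C' ∧
      ∀ (n p K : ℕ), 1 ≤ K → C * (p : ℝ) < (n : ℝ) →
      ∀ (Ω : Type*) [MeasurableSpace Ω] (P : Measure Ω) [IsProbabilityMeasure P]
        (A : Matrix (Fin p) (Fin K) ℝ) (β : Fin K → ℝ)
        (Z : Ω → Fin K → ℝ) (E : Ω → Fin p → ℝ) (ε : Ω → ℝ),
      IsSubGaussianFactorModel P c A Z E ε → A.rank = K → (covMat P Z).rank = K →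
      ∀ (Ω' : Type*) [MeasurableSpace Ω'] (P' : Measure Ω') [IsProbabilityMeasure P']
        (Zs : Fin n → Ω' → Fin K → ℝ) (Es : Fin n → Ω' → Fin p → ℝ) (εs : Fin n → Ω' → ℝ),
      IsIIDSample P Z E ε P' Zs Es εs →
      1 - c' / (n : ℝ) ≤ P'.real {ω |
        ENNReal.ofReal
            (risk P (features A Z E) (response β Z ε)
                (gls (fun i => features A (Zs i) (Es i)) (fun i => response β (Zs i) (εs i)) ω)
              - Var[ε; P]) ≤
          ENNReal.ofReal C' *
            (ENNReal.ofReal (sqNormOf (covMat P Z) β) / snr A (covMat P Z) (covMat P E) +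
              ENNReal.ofReal ((p : ℝ) / (n : ℝ) * Var[ε; P] * Real.log n))} := by
  have : 0 < c ⊔ 1 := lt_sup_of_lt_right one_pos
  refine ⟨4 / (3 / (4096 * ↑(c ⊔ 1)) ^ 2), 8 / (3 / (4096 * ↑(c ⊔ 1)) ^ 2) + 2,
    50000 * ↑(c ⊔ 1) ^ 2, by positivity, by positivity, by positivity, ?_⟩
  intro n p K hK hn Ω _ P _ A β Z E ε hmodel hA hZ Ω' _ P' _ Zs Es εs hs
  have hcov := covMat_posSemidef hmodel.memLp_factor
  obtain ⟨v, hv, hvβ⟩ := exists_transpose_mulVec_eq_and_ordEig_mul_le hcov hA hZ β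
  refine ((hmodel.mono le_sup_left).one_sub_div_le_measureReal_risk_gls_le le_sup_right hv hs
    hn).trans (measureReal_mono fun ω hω => ?_)
  have hE : ENNReal.ofReal (sqNormOf (covMat P E) v) ≤ _ :=
    ofReal_sqNormOf_le_ofReal_div_snr (ordEig_mul_mul_transpose_pos hcov hA hZ hK) hvβ
  refine (ENNReal.ofReal_le_ofReal hω).trans ?_
  rw [ENNReal.ofReal_mul (by positivity)]
  gcongr
  exact ENNReal.ofReal_add_le.trans (add_le_add_left hE _)

theorem mainTheorem10 (M : ℝ) (hM : 0 < M) :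
    ∃ C c C' : ℝ, 0 < C ∧ 0 < c ∧ 0 < C' ∧
      ∀ (n p K : ℕ), 1 ≤ K → K ≤ p → C * (p : ℝ) < (n : ℝ) →
      -- the population `(Z, E, ε)` with `X = A Z + E` and `y = Zᵀ β + ε`
      ∀ (Ω : Type*) [MeasurableSpace Ω] (P : Measure Ω) [IsProbabilityMeasure P]
        (A : Matrix (Fin p) (Fin K) ℝ) (β : Fin K → ℝ)
        (Z : Ω → Fin K → ℝ) (E : Ω → Fin p → ℝ) (ε : Ω → ℝ),
      FactorRegression.IsFactorTriple P Z E ε →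
      A.rank = K → (FactorRegression.covMat P Z).rank = K →
      FactorRegression.SubGaussianData P M (FactorRegression.features A Z E)
        (FactorRegression.response β Z ε) →
      FactorRegression.SubGaussianFactors P M Z E ε →
      -- the training sample
      ∀ (Ω' : Type*) [MeasurableSpace Ω'] (P' : Measure Ω') [IsProbabilityMeasure P']
        (Zs : Fin n → Ω' → Fin K → ℝ) (Es : Fin n → Ω' → Fin p → ℝ) (εs : Fin n → Ω' → ℝ),
      FactorRegression.IsIIDSample P Z E ε P' Zs Es εs →
      1 - c / (n : ℝ) ≤ P'.real {ω |
        ENNReal.ofReal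
            (FactorRegression.risk P (FactorRegression.features A Z E)
                (FactorRegression.response β Z ε)
                (FactorRegression.gls (fun i => FactorRegression.features A (Zs i) (Es i))
                  (fun i => FactorRegression.response β (Zs i) (εs i)) ω)
              - Var[ε; P]) ≤
          ENNReal.ofReal C' *
            (FactorRegression.condNumber (FactorRegression.covMat P E) *
                (ENNReal.ofReal (FactorRegression.sqNormOf (FactorRegression.covMat P Z) β) /
                  FactorRegression.snr A (FactorRegression.covMat P Z)
                    (FactorRegression.covMat P E)) +
              ENNReal.ofReal ((p : ℝ) / (n : ℝ) * Var[ε; P] * Real.log n))} := by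
  obtain ⟨C, c, C', hC, hc, hC', hbound⟩ := mainTheorem10_general (8 * M ^ 2).toNNReal
  refine ⟨C, c, C', hC, hc, hC', fun n p K hK _ hn Ω _ P _ A β Z E ε hfactor hA hZ hdata hsub
    Ω' _ P' _ Zs Es εs hs => ?_⟩
  refine (hbound n p K hK hn Ω P A β Z E ε (hfactor.isSubGaussianFactorModel hM hdata hsub) hA hZ
    Ω' P' Zs Es εs hs).trans (measureReal_mono fun ω hω => ?_)
  rw [Set.mem_ofPred_eq] at hω ⊢
  refine hω.trans ?_
  gcongr
  exact FactorRegression.div_snr_le_condNumber_mul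
    (FactorRegression.ordEig_mul_mul_transpose_pos
      (FactorRegression.covMat_posSemidef hfactor.memLp_Z) hA hZ hK)
    (FactorRegression.covMat_posSemidef hfactor.memLp_E) _
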